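/- **Setting.** Let $\mathcal C$ be a pivotal monoidal Ab-category with ground ring $K=\operatorname{End}(\mathbb 1)$ and $K$-bilinear composition and tensor product; write $V^*$ for the dual object of $V$ and $b_V:\mathbb 1\to V\otimes V^*$, $d_V:V^*\otimes V\to\mathbb 1$, $b'_V:\mathbb 1\to V^*\otimes V$, $d'_V:V\otimes V^*\to\mathbb 1$ for the duality morphisms. An object $V$ is simple if every endomorphism of $V$ is $a\operatorname{Id}_V$ for a unique $a\in K$. *Basic data:* a set $I$ with an involution $i\mapsto i^*$, simple objects $V_i$ $(i\in I)$ with $\operatorname{Hom}(V_i,V_j)=0$ for $i\ne j$, and isomorphisms $w_i:V_i\to V_{i^*}^*$ with $d_{V_i}(w_{i^*}\otimes \operatorname{Id})=d'_{V_{i^*}}(\operatorname{Id}\otimes w_i)$. *Graphs.* $G$ denotes the Reshetikhin–Turaev functor on planar ribbon graphs colored by $\mathcal C$. If a ribbon graph $T\subset S^2$ is cut at an edge colored by $V_i$, one gets a ribbon graph $T_{V_i}$ in the strip with one input and one output, and $\langle T_{V_i}\rangle\in K$ is defined by $G(T_{V_i})=\langle T_{V_i}\rangle\operatorname{Id}_{V_i}$.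 Let $I_0\subset I$ satisfy $I_0^*=I_0$ and let $\mathsf d:I_0\to K$ satisfy $\mathsf d(i^*)=\mathsf d(i)$. The pair $(I_0,\mathsf d)$ is *t-ambi* if $\mathsf d(i)\langle T_{V_i}\rangle=\mathsf d(j)\langle T_{V_j}\rangle$ for all $i,j\in I_0$ and all cutting presentations $T_{V_i},T_{V_j}$ of any connected ribbon graph $T\subset S^2$ all of whose coupons have three legs and all of whose edges are colored by objects $V_k$, $k\in I$. Fix a t-ambi pair. Put $G'(T)=\mathsf d(i)\langle T_{V_i}\rangle$ for any cutting presentation with $i\in I_0$; this is also well defined for connected graphs having in addition straight coupons (one leg on the bottom side and one on the top side) colored by isomorphisms. *Multiplicity modules and $6j$-symbols.* Let $H(i,j,k)=\operatorname{Hom}(\mathbb 1,V_i\otimes V_j\otimes V_k)$. A trivalent graph in $S^2$ with oriented edges labeled by $I$ is thickened by placing a coupon $w_i$ on each edge labeled $i$, and a coupon colored by an element of $H(i,j,k)$ at each vertex, where $i,j,k$ are the labels at the vertex in cyclic order (an outgoing edge labeled $i$ counts as $i^*$). Applying $G'$ to the theta graph with two edges labeled $i,j$ going from one vertex to the other and one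 edge labeled $k$ going back gives the pairing $$H(i,j,k^*)\otimes_K H(k,j^*,i^*)\to K ,\qquad (*)$$ and contraction along it is denoted $*_{ijk^*}$. Applying $G'$ to the tetrahedron graph with edges $i,j,k,l,m,n$ whose vertices have the label triples $(i,j,k^*)$, $(k,l,m^*)$, $(n,l^*,j^*)$, $(m,n^*,i^*)$ gives the *modified $6j$-symbol* $$\left|\begin{smallmatrix} i&j&k\\ l&m&n\end{smallmatrix}\right|\in\operatorname{Hom}_K\bigl(H(i,j,k^*)\otimes H(k,l,m^*)\otimes H(n,l^*,j^*)\otimes H(m,n^*,i^*),K\bigr).$$ (Here $G'=0$ if no label lies in $I_0$.) *Goodness.* A pair $(i,j)\in I^2$ is *good* if $V_i\otimes V_j$ is a finite direct sum of objects $V_k$ with $k\in I_0$ and $\mathsf d(k)$ invertible in $K$. A tuple $(i,j,k,l,m,n)\in I^6$ is *strongly good* if $m,n\in I_0$ and the pairs $(i,j),(j,l),(i,n),(k,l)$ are good. **Theorem (Biedenharn–Elliott identity).** Let $j_0,\dots,j_8\in I$ be such that $(j_1,j_2,j_5,j_8,j_0,j_7)$ and $(j_5,j_3,j_6,j_4,j_0,j_8)$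 are strongly good, $j_7,j_8\in I_0$, and $(j_2,j_3)$ is good. Put $J=\{j\in I: \operatorname{Hom}(V_j,V_{j_2}\otimes V_{j_3})\neq0\}$ and assume that $(j_1,j)$ and $(j,j_4)$ are good for all $j\in J$. Then: 1. $J$ is a finite subset of $I_0$. For all $j\in J$ the tuples $(j_1,j,j_6,j_4,j_0,j_7)$ and $(j_2,j_3,j,j_4,j_7,j_8)$ are strongly good, and so is $(j_1,j_2,j_5,j_3,j_6,j)$ provided that $j_6\in I_0$. 2. For each of these tuples $(i,j,k,l,m,n)$ (also if $j_6\notin I_0$), and for the two tuples in the hypothesis, the pairings $(*)$ induce an isomorphism from $H(k,j^*,i^*)\otimes H(m,l^*,k^*)\otimes H(j,l,n^*)\otimes H(i,n,m^*)$ onto the module $\operatorname{Hom}_K(\cdots,K)$ above, so that the $6j$-symbol may be viewed as an element of this tensor product. 3. With the $6j$-symbols so viewed, $$\sum_{j\in J}\mathsf d(j)\; *_{j_2j_3j^*}*_{jj_4j_7^*}*_{j_1jj_6^*}\left(\left|\begin{smallmatrix} j_1&j_2&j_5\\ j_3&j_6&j\end{smallmatrix}\right|\otimes\left|\begin{smallmatrix}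 j_1&j&j_6\\ j_4&j_0&j_7\end{smallmatrix}\right|\otimes\left|\begin{smallmatrix} j_2&j_3&j\\ j_4&j_7&j_8\end{smallmatrix}\right|\right)= *_{j_5j_8j_0^*}\left(\left|\begin{smallmatrix} j_5&j_3&j_6\\ j_4&j_0&j_8\end{smallmatrix}\right|\otimes\left|\begin{smallmatrix} j_1&j_2&j_5\\ j_8&j_0&j_7\end{smallmatrix}\right|\right)$$ in $H(j_6,j_3^*,j_5^*)\otimes H(j_5,j_2^*,j_1^*)\otimes H(j_0,j_4^*,j_6^*)\otimes H(j_1,j_7,j_0^*)\otimes H(j_2,j_8,j_7^*)\otimes H(j_3,j_4,j_8^*)$. -/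

import Mathlib

namespace ModifiedSixJ

open CategoryTheory MonoidalCategory

universe v u w t

noncomputable section

/-! Pivotal categories -/

section Pivotal

variable (C : Type u) [Category.{v} C] [MonoidalCategory C]

/-- A left duality `b_V : 𝟙 ⟶ V ⊗ V*`, `d_V : V* ⊗ V ⟶ 𝟙` and a right duality
`b'_V : 𝟙 ⟶ V* ⊗ V`, `d'_V : V ⊗ V* ⟶ 𝟙` with the same dual objects. -/
class TwoSidedDuality where
  dual : C → C
  left : ∀ V : C, ExactPairing V (dual V)
  right : ∀ V : C, ExactPairing (dual V) V

variable {C} [TwoSidedDuality C]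

abbrev dual (V : C) : C := TwoSidedDuality.dual V

def coevL (V : C) : 𝟙_ C ⟶ V ⊗ dual V := (TwoSidedDuality.left V).coevaluation'
def evL (V : C) : dual V ⊗ V ⟶ 𝟙_ C := (TwoSidedDuality.left V).evaluation'
def coevR (V : C) : 𝟙_ C ⟶ dual V ⊗ V := (TwoSidedDuality.right V).coevaluation'
def evR (V : C) : V ⊗ dual V ⟶ 𝟙_ C := (TwoSidedDuality.right V).evaluation'

/-- The transpose `f*` formed with the left duality. -/
def transposeL {V W : C} (f : V ⟶ W) : dual W ⟶ dual V :=
  (ρ_ (dual W)).inv ≫ dual W ◁ coevL V ≫ dual W ◁ (f ▷ dual V) ≫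
    (α_ (dual W) W (dual V)).inv ≫ evL W ▷ dual V ≫ (λ_ (dual V)).hom

/-- The transpose `f*` formed with the right duality. -/
def transposeR {V W : C} (f : V ⟶ W) : dual W ⟶ dual V :=
  (λ_ (dual W)).inv ≫ coevR V ▷ dual W ≫ (dual V ◁ f) ▷ dual W ≫
    (α_ (dual V) W (dual W)).hom ≫ dual V ◁ evR W ≫ (ρ_ (dual V)).hom

/-- The comparison `W* ⊗ V* ⟶ (V ⊗ W)*` formed with the left duality. -/
def gammaL (V W : C) : dual W ⊗ dual V ⟶ dual (V ⊗ W) :=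
  (ρ_ _).inv ≫ (dual W ⊗ dual V) ◁ coevL (V ⊗ W) ⊗≫
    dual W ◁ (evL V ▷ (W ⊗ dual (V ⊗ W))) ⊗≫
    evL W ▷ dual (V ⊗ W) ≫ (λ_ _).hom

/-- The comparison `W* ⊗ V* ⟶ (V ⊗ W)*` formed with the right duality. -/
def gammaR (V W : C) : dual W ⊗ dual V ⟶ dual (V ⊗ W) :=
  (λ_ _).inv ≫ coevR (V ⊗ W) ▷ (dual W ⊗ dual V) ⊗≫
    (dual (V ⊗ W) ⊗ V) ◁ (evR W ▷ dual V) ⊗≫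
    dual (V ⊗ W) ◁ evR V ≫ (ρ_ _).hom

variable (C) in
/-- A pivotal category: the two dualities give the same transposes and the same comparison
isomorphisms. -/
class PivotalCategory extends TwoSidedDuality C where
  transpose_eq : ∀ {V W : C} (f : V ⟶ W), transposeL f = transposeR f
  gamma_eq : ∀ V W : C, gammaL V W = gammaR V W

/-- Closing the strand `X` on the left. -/
def leftTrace (X : C) {A B : C} (f : X ⊗ A ⟶ X ⊗ B) : A ⟶ B :=
  (λ_ A).inv ≫ coevR X ▷ A ≫ (α_ (dual X) X A).hom ≫ dual X ◁ f ≫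
    (α_ (dual X) X B).inv ≫ evL X ▷ B ≫ (λ_ B).hom

/-- Closing the strand `Y` on the right. -/
def rightTrace (Y : C) {A B : C} (f : A ⊗ Y ⟶ B ⊗ Y) : A ⟶ B :=
  (ρ_ A).inv ≫ A ◁ coevL Y ≫ (α_ A Y (dual Y)).inv ≫ f ▷ dual Y ≫
    (α_ B Y (dual Y)).hom ≫ B ◁ evR Y ≫ (ρ_ B).hom

end Pivotal

/-! Basic data -/

section Basic

variable (K : Type w) [CommRing K] (C : Type u) [Category.{v} C] [MonoidalCategory C]
  [Preadditive C] [Linear K C]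

/-- An object is simple if each of its endomorphisms is a unique scalar multiple of the
identity. -/
def IsSimpleObj {C : Type u} [Category.{v} C] [Preadditive C] [Linear K C] (V : C) : Prop :=
  Function.Bijective (fun a : K => a • 𝟙 V)

/-- Basic data: simple objects `V i` indexed by a set with involution, without nonzero
morphisms between different ones, and isomorphisms `w i : V i ≅ (V i*)*` such that
`d_{V_i} (w_{i*} ⊗ id) = d'_{V_{i*}} (id ⊗ w_i)`. -/
structure BasicData [TwoSidedDuality C] (I : Type t) where
  star : I → I
  star_star : ∀ i, star (star i) = i
  V : I → C
  simple : ∀ i, IsSimpleObj K (V i)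
  hom_eq_zero : ∀ i j, i ≠ j → ∀ f : V i ⟶ V j, f = 0
  w : ∀ i, V i ≅ dual (V (star i))
  w_compat : ∀ i,
    ((w (star i)).hom ≫ eqToHom (by rw [star_star])) ▷ V i ≫ evL (V i) =
      V (star i) ◁ (w i).hom ≫ evR (V (star i))

end Basic

section Main

variable {K : Type w} [CommRing K] {C : Type u} [Category.{v} C] [MonoidalCategory C]
  [Preadditive C] [Linear K C] [PivotalCategory C] {I : Type t} (B : BasicData K C I)

/-! Planar diagrams -/

/-- A horizontal section of a diagram: the strands from left to right, each with its label and
its orientation (`true`: downwards, `false`: upwards). -/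
abbrev Word (I : Type t) := List (I × Bool)

/-- A downward strand. -/
abbrev dn {I : Type t} (i : I) : I × Bool := (i, true)
/-- An upward strand. -/
abbrev up {I : Type t} (i : I) : I × Bool := (i, false)

namespace BasicData

def strand : I × Bool → C
  | (i, true) => B.V i
  | (i, false) => dual (B.V i)

def obj : Word I → C
  | [] => 𝟙_ C
  | s :: W => B.strand s ⊗ obj W

def appendIso : (X Y : Word I) → (B.obj (X ++ Y) ≅ B.obj X ⊗ B.obj Y)
  | [], Y => (λ_ (B.obj Y)).symm
  | s :: X, Y => whiskerLeftIso (B.strand s) (appendIso X Y) ≪≫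
      (α_ (B.strand s) (B.obj X) (B.obj Y)).symm

/-- Adding vertical strands `R` on the right. -/
def addRight {S T : Word I} (f : B.obj S ⟶ B.obj T) (R : Word I) :
    B.obj (S ++ R) ⟶ B.obj (T ++ R) :=
  (B.appendIso S R).hom ≫ f ▷ B.obj R ≫ (B.appendIso T R).inv

/-- Adding vertical strands `L` on the left. -/
def addLeft : (L : Word I) → {S T : Word I} → (B.obj S ⟶ B.obj T) →
    (B.obj (L ++ S) ⟶ B.obj (L ++ T))
  | [], _, _, f => f
  | s :: L, _, _, f => B.strand s ◁ addLeft L f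

/-- Elementary pieces of a ribbon graph (read from bottom to top): coupons, and the cups and
caps that close a strand to the right or to the left. -/
inductive Piece : Word I → Word I → Type (max v t)
  | coupon (S T : Word I) (f : B.obj S ⟶ B.obj T) : Piece S T
  | cupL (i : I) : Piece [] [dn i, up i]
  | capL (i : I) : Piece [up i, dn i] []
  | cupR (i : I) : Piece [] [up i, dn i]
  | capR (i : I) : Piece [dn i, up i] []

def Piece.eval : {S T : Word I} → B.Piece S T → (B.obj S ⟶ B.obj T)
  | _, _, .coupon _ _ f => f
  | _, _, .cupL i => coevL (B.V i) ≫ B.V i ◁ (ρ_ (dual (B.V i))).inv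
  | _, _, .capL i => dual (B.V i) ◁ (ρ_ (B.V i)).hom ≫ evL (B.V i)
  | _, _, .cupR i => coevR (B.V i) ≫ dual (B.V i) ◁ (ρ_ (B.V i)).inv
  | _, _, .capR i => B.V i ◁ (ρ_ (dual (B.V i))).hom ≫ evR (B.V i)

/-- Ribbon graphs in the strip with edges coloured by the objects `V i`, in generic position,
cut into layers (listed from bottom to top), each with one elementary piece between vertical
strands `L` and `R`. Every such ribbon graph is isotopic to one of this form. -/
inductive Diagram : Word I → Word I → Type (max v t)
  | nil (W : Word I) : Diagram W W
  | cons (L R : Word I) {S T Z : Word I} (g : B.Piece S T) (D : Diagram (L ++ (T ++ R)) Z) :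
      Diagram (L ++ (S ++ R)) Z

variable {B}

/-- The morphism of `C` represented by a ribbon graph. -/
def Diagram.eval : {X Z : Word I} → B.Diagram X Z → (B.obj X ⟶ B.obj Z)
  | _, _, .nil W => 𝟙 (B.obj W)
  | _, _, .cons L R g D => B.addLeft L (B.addRight (g.eval B) R) ≫ D.eval

/-- All coupons are adjacent to three half-edges. -/
def Diagram.IsTrivalent : {X Z : Word I} → B.Diagram X Z → Prop
  | _, _, .nil _ => True
  | _, _, .cons _ _ (.coupon S T _) D => S.length + T.length = 3 ∧ D.IsTrivalent
  | _, _, .cons _ _ _ D => D.IsTrivalent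

/-- `(n, a)` is the `a`-th strand at the `n`-th horizontal level. -/
def Diagram.IsPoint : {X Z : Word I} → B.Diagram X Z → ℕ × ℕ → Prop
  | _, _, .nil W, p => p.1 = 0 ∧ p.2 < W.length
  | _, _, .cons (S := S) L R _ D, p =>
      (p.1 = 0 ∧ p.2 < (L ++ (S ++ R)).length) ∨ ∃ n, p.1 = n + 1 ∧ D.IsPoint (n, p.2)

/-- Two strands at consecutive levels, or at the same level, are joined within one layer: by a
vertical strand, or by the elementary piece of the layer. -/
def Diagram.Joined : {X Z : Word I} → B.Diagram X Z → ℕ × ℕ → ℕ × ℕ → Prop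
  | _, _, .nil _, _, _ => False
  | _, _, .cons (S := S) (T := T) L R _ D, p, q =>
      (∃ a < L.length, p = (0, a) ∧ q = (1, a)) ∨
      (∃ a < R.length, p = (0, L.length + S.length + a) ∧ q = (1, L.length + T.length + a)) ∨
      (((∃ a < S.length, p = (0, L.length + a)) ∨ ∃ a < T.length, p = (1, L.length + a)) ∧
        ((∃ a < S.length, q = (0, L.length + a)) ∨ ∃ a < T.length, q = (1, L.length + a))) ∨
      (∃ n m, p.1 = n + 1 ∧ q.1 = m + 1 ∧ D.Joined (n, p.2) (m, q.2))

def Diagram.IsConnected {X Z : Word I} (D : B.Diagram X Z) : Prop :=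
  ∀ p q, D.IsPoint p → D.IsPoint q → Relation.EqvGen D.Joined p q

variable (B)

/-! Cutting presentations -/

theorem simple_of_iso {V W : C} (e : V ≅ W) (h : IsSimpleObj K V) : IsSimpleObj K W := by
  constructor
  · intro a b hab
    apply h.1
    have : e.hom ≫ (a • 𝟙 W) ≫ e.inv = e.hom ≫ (b • 𝟙 W) ≫ e.inv := by
      simpa using congrArg (fun t => e.hom ≫ t ≫ e.inv) hab
    simpa using this
  · intro f
    obtain ⟨a, ha⟩ := h.2 (e.hom ≫ f ≫ e.inv)
    refine ⟨a, ?_⟩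
    have := congrArg (fun t => e.inv ≫ t ≫ e.hom) ha
    simpa using this

theorem simple_strand (s : I × Bool) : IsSimpleObj K (B.strand s) := by
  obtain ⟨i, _ | _⟩ := s
  · exact simple_of_iso (B.w (B.star i) ≪≫ eqToIso (by rw [B.star_star]; rfl))
      (B.simple (B.star i))
  · exact B.simple i

/-- The scalar `⟨f⟩` with `f = ⟨f⟩ • id`, for an endomorphism of a (possibly dual) `V i`. -/
def bracket (s : I × Bool) : (B.strand s ⟶ B.strand s) →ₗ[K] K :=
  (LinearEquiv.ofBijective (LinearMap.toSpanSingleton K (B.strand s ⟶ B.strand s) (𝟙 _))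
    (B.simple_strand s)).symm.toLinearMap

theorem bracket_smul_id (s : I × Bool) (f : B.strand s ⟶ B.strand s) :
    B.bracket s f • 𝟙 (B.strand s) = f :=
  (LinearEquiv.ofBijective (LinearMap.toSpanSingleton K (B.strand s ⟶ B.strand s) (𝟙 _))
    (B.simple_strand s)).apply_symm_apply f

/-- The tensor product of the strands to the left of the `n`-th one. -/
def leftOf : (W : Word I) → Fin W.length → C
  | _ :: _, ⟨0, _⟩ => 𝟙_ C
  | s :: W, ⟨n + 1, h⟩ => B.strand s ⊗ leftOf W ⟨n, Nat.lt_of_succ_lt_succ h⟩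

/-- The tensor product of the strands to the right of the `n`-th one. -/
def rightOf : (W : Word I) → Fin W.length → C
  | _ :: W, ⟨0, _⟩ => B.obj W
  | _ :: W, ⟨n + 1, h⟩ => rightOf W ⟨n, Nat.lt_of_succ_lt_succ h⟩

def splitIso : (W : Word I) → (n : Fin W.length) →
    (B.obj W ≅ B.leftOf W n ⊗ (B.strand (W.get n) ⊗ B.rightOf W n))
  | s :: W, ⟨0, _⟩ => (λ_ (B.strand s ⊗ B.obj W)).symm
  | s :: W, ⟨n + 1, h⟩ =>
      whiskerLeftIso (B.strand s) (splitIso W ⟨n, Nat.lt_of_succ_lt_succ h⟩) ≪≫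
        (α_ (B.strand s) _ _).symm

/-- The value of the cutting presentation of a closed ribbon graph in the sphere, obtained by
cutting it at the `n`-th strand of a horizontal level `W`. Here `below` and `above` are the values
of the parts of the graph below and above this level. The cutting presentation is obtained by
placing the part below on top of the part above, and by closing on the sphere the strands to the
left of the `n`-th one around the left, and those to the right of it around the right. -/
def cutEnd (W : Word I) (n : Fin W.length) (below : 𝟙_ C ⟶ B.obj W) (above : B.obj W ⟶ 𝟙_ C) :
    B.strand (W.get n) ⟶ B.strand (W.get n) :=
  rightTrace (B.rightOf W n) (leftTrace (B.leftOf W n)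
    ((B.splitIso W n).inv ≫ (above ≫ below) ≫ (B.splitIso W n).hom))

/-- The pairs `(i, ⟨T⟩)` for the cutting presentations `T` at the strands of a given level, `i`
being the label of the strand. (For an upward strand, turning the picture by `π` gives a cutting
presentation with downward ends and the same scalar.) -/
def levelCuts (W : Word I) (below : 𝟙_ C ⟶ B.obj W) (above : B.obj W ⟶ 𝟙_ C) : List (I × K) :=
  List.ofFn fun n : Fin W.length =>
    ((W.get n).1, B.bracket (W.get n) (B.cutEnd W n below above))

variable {B} in
/-- The pairs `(i, ⟨T⟩)` for the cutting presentations `T` at all strands of all levels; the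
morphisms `below` and `above` are the values of what is below and above the diagram. -/
def Diagram.cutsAux : {X Z : Word I} → B.Diagram X Z → (𝟙_ C ⟶ B.obj X) → (B.obj Z ⟶ 𝟙_ C) →
    List (I × K)
  | _, _, .nil W, below, above => B.levelCuts W below above
  | _, _, .cons L R g D, below, above =>
      B.levelCuts _ below ((Diagram.cons L R g D).eval ≫ above) ++
        D.cutsAux (below ≫ B.addLeft L (B.addRight (g.eval B) R)) above

variable {B} in
/-- The list of the pairs `(i, ⟨T_{V_i}⟩)` where `T_{V_i}` runs over the cutting presentations of
a closed ribbon graph in the sphere. -/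
def Diagram.cuts (D : B.Diagram [] []) : List (I × K) := D.cutsAux (𝟙 (𝟙_ C)) (𝟙 (𝟙_ C))

/-- Trivalent-ambidextrous pairs `(I₀, d)`. Only the values of `d` on `I₀` matter. -/
structure IsTAmbi (I₀ : Set I) (d : I → K) : Prop where
  star_mem : ∀ i ∈ I₀, B.star i ∈ I₀
  d_star : ∀ i ∈ I₀, d (B.star i) = d i
  ambi : ∀ T : B.Diagram [] [], T.IsTrivalent → T.IsConnected →
    ∀ p ∈ T.cuts, ∀ q ∈ T.cuts, p.1 ∈ I₀ → q.1 ∈ I₀ → d p.1 * p.2 = d q.1 * q.2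

open Classical in
variable {B} in
/-- The invariant `G'(T) = d(i) ⟨T_{V_i}⟩`, where `T_{V_i}` is a cutting presentation of `T` with
`i ∈ I₀` (for t-ambi pairs the value does not depend on its choice; we take the first one). -/
def Diagram.gPrime (T : B.Diagram [] []) (I₀ : Set I) (d : I → K) : K :=
  match T.cuts.find? (fun p => decide (p.1 ∈ I₀)) with
  | some p => d p.1 * p.2
  | none => 0

/-! Multiplicity modules and thickened trivalent graphs -/

/-- The multiplicity module `H(i, j, k) = Hom(𝟙, V i ⊗ V j ⊗ V k)`. -/
abbrev H (i j k : I) : Type v := 𝟙_ C ⟶ B.V i ⊗ (B.V j ⊗ B.V k)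

variable {B}

/-- A vertex as a coupon without arrows on its bottom side, and with three arrows, labelled
`i, j, k` from left to right, entering its top side. -/
def vertex {i j k : I} (x : B.H i j k) : B.Piece [] [dn i, dn j, dn k] :=
  .coupon _ _ (x ≫ B.V i ◁ B.V j ◁ (ρ_ (B.V k)).inv)

/-- The straight coupon coloured by `w i`, in the middle of an edge labelled `i`. -/
def edge (B : BasicData K C I) (i : I) : B.Piece [dn i] [up (B.star i)] :=
  .coupon _ _ ((B.w i).hom ▷ 𝟙_ C)

/-- The thickened theta graph with two vertices, and three edges: `i`, `j` from the second vertex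
(coloured by `y`) to the first vertex (coloured by `x`), and `k` from the first one to the
second one. -/
def thetaGraph {i j k : I} (x : B.H i j (B.star k)) (y : B.H k (B.star j) (B.star i)) :
    B.Diagram [] [] :=
  .cons [] [] (vertex y) <|
  .cons [dn k, dn (B.star j), dn (B.star i)] [] (vertex x) <|
  .cons [dn k, dn (B.star j), dn (B.star i)] [dn j, dn (B.star k)] (edge B i) <|
  .cons [dn k, dn (B.star j)] [dn j, dn (B.star k)] (.capR (B.star i)) <|
  .cons [dn k, dn (B.star j)] [dn (B.star k)] (edge B j) <|
  .cons [dn k] [dn (B.star k)] (.capR (B.star j)) <|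
  .cons [] [dn (B.star k)] (edge B k) <|
  .cons [] [] (.capL (B.star k)) <|
  .nil []

/-- The thickened tetrahedron `Γ(i, j, k, l, m, n)`, with vertices coloured by vectors
`x₁ ∈ H(i, j, k*)`, `x₂ ∈ H(k, l, m*)`, `x₃ ∈ H(n, l*, j*)`, `x₄ ∈ H(m, n*, i*)`. -/
def tetrahedron {i j k l m n : I} (x₁ : B.H i j (B.star k)) (x₂ : B.H k l (B.star m))
    (x₃ : B.H n (B.star l) (B.star j)) (x₄ : B.H m (B.star n) (B.star i)) : B.Diagram [] [] :=
  .cons [] [] (vertex x₄) <|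
  .cons [dn m, dn (B.star n), dn (B.star i)] [] (vertex x₁) <|
  .cons [dn m, dn (B.star n), dn (B.star i)] [dn j, dn (B.star k)] (edge B i) <|
  .cons [dn m, dn (B.star n)] [dn j, dn (B.star k)] (.capR (B.star i)) <|
  .cons [dn m, dn (B.star n)] [dn j, dn (B.star k)] (vertex x₃) <|
  .cons [dn m, dn (B.star n)] [dn (B.star l), dn (B.star j), dn j, dn (B.star k)] (edge B n) <|
  .cons [dn m] [dn (B.star l), dn (B.star j), dn j, dn (B.star k)] (.capR (B.star n)) <|
  .cons [dn m, dn (B.star l), dn (B.star j)] [dn (B.star k)] (edge B j) <|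
  .cons [dn m, dn (B.star l)] [dn (B.star k)] (.capR (B.star j)) <|
  .cons [dn m, dn (B.star l), dn (B.star k)] [] (vertex x₂) <|
  .cons [dn m, dn (B.star l), dn (B.star k)] [dn l, dn (B.star m)] (edge B k) <|
  .cons [dn m, dn (B.star l)] [dn l, dn (B.star m)] (.capR (B.star k)) <|
  .cons [dn m, dn (B.star l)] [dn (B.star m)] (edge B l) <|
  .cons [dn m] [dn (B.star m)] (.capR (B.star l)) <|
  .cons [] [dn (B.star m)] (edge B m) <|
  .cons [] [] (.capL (B.star m)) <|
  .nil []

/-! Linearity in the colours of the vertices -/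

section Linearity

variable [MonoidalPreadditive C] [MonoidalLinear K C]

variable (B) in
def cutEndLin (W : Word I) (n : Fin W.length) :
    (B.obj W ⟶ B.obj W) →ₗ[K] (B.strand (W.get n) ⟶ B.strand (W.get n)) where
  toFun f := rightTrace (B.rightOf W n) (leftTrace (B.leftOf W n)
    ((B.splitIso W n).inv ≫ f ≫ (B.splitIso W n).hom))
  map_add' f g := by simp [rightTrace, leftTrace]
  map_smul' a f := by simp [rightTrace, leftTrace]

variable {F : Type*} [AddCommGroup F] [Module K F]

/-- A family of lists of pairs with fixed first entries and linear second entries. -/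
def LinList (c : F → List (I × K)) : Prop :=
  ∃ M : List (I × (F →ₗ[K] K)), ∀ f, c f = M.map fun p => (p.1, p.2 f)

theorem LinList.append {c c' : F → List (I × K)} (h : LinList c) (h' : LinList c') :
    LinList fun f => c f ++ c' f := by
  obtain ⟨M, hM⟩ := h
  obtain ⟨M', hM'⟩ := h'
  exact ⟨M ++ M', fun f => by simp [hM, hM']⟩

theorem linList_level (W : Word I) (below : F → (𝟙_ C ⟶ B.obj W)) (above : F → (B.obj W ⟶ 𝟙_ C))
    (φ : F →ₗ[K] (B.obj W ⟶ B.obj W)) (h : ∀ f, above f ≫ below f = φ f) :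
    LinList fun f => B.levelCuts W (below f) (above f) := by
  refine ⟨List.ofFn fun n : Fin W.length =>
    ((W.get n).1, (B.bracket (W.get n)) ∘ₗ (B.cutEndLin W n) ∘ₗ φ), fun f => ?_⟩
  rw [List.map_ofFn]
  refine congrArg List.ofFn (funext fun n => ?_)
  simp only [Function.comp, LinearMap.comp_apply, ← h]
  rfl

theorem linList_cutsAux_below {X Z : Word I} (D : B.Diagram X Z)
    (φ : F →ₗ[K] (𝟙_ C ⟶ B.obj X)) (above : B.obj Z ⟶ 𝟙_ C) :
    LinList fun f => D.cutsAux (φ f) above := by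
  induction D with
  | nil W => exact linList_level W _ _ (Linear.leftComp K _ above ∘ₗ φ) fun f => rfl
  | cons L R g D ih =>
    exact (linList_level _ _ _ (Linear.leftComp K _ (_ ≫ above) ∘ₗ φ) fun f => rfl).append
      (ih (Linear.rightComp K _ (B.addLeft L (B.addRight (g.eval B) R)) ∘ₗ φ) above)

theorem addLeft_add (L : Word I) {S T : Word I} (f g : B.obj S ⟶ B.obj T) :
    B.addLeft L (f + g) = B.addLeft L f + B.addLeft L g := by
  induction L with
  | nil => rfl
  | cons s L ih => exact (congrArg (B.strand s ◁ ·) ih).trans (MonoidalPreadditive.whiskerLeft_add _ _)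

theorem addLeft_smul (L : Word I) {S T : Word I} (a : K) (f : B.obj S ⟶ B.obj T) :
    B.addLeft L (a • f) = a • B.addLeft L f := by
  induction L with
  | nil => rfl
  | cons s L ih => exact (congrArg (B.strand s ◁ ·) ih).trans (MonoidalLinear.whiskerLeft_smul _ a _)

variable (B) in
def layerLin (L R S T : Word I) :
    (B.obj S ⟶ B.obj T) →ₗ[K] (B.obj (L ++ (S ++ R)) ⟶ B.obj (L ++ (T ++ R))) where
  toFun f := B.addLeft L (B.addRight f R)
  map_add' f g := by simp [addRight, addLeft_add]
  map_smul' a f := by simp [addRight, addLeft_smul]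

/-- A family of ribbon graphs whose values and cutting presentations depend linearly on a
parameter. -/
structure LinFam {X Z : Word I} (D : F → B.Diagram X Z) : Prop where
  eval : ∃ φ : F →ₗ[K] (B.obj X ⟶ B.obj Z), ∀ f, (D f).eval = φ f
  cuts : ∀ below above, LinList fun f => (D f).cutsAux below above

theorem LinFam.cons {L R S T Z : Word I} {D : F → B.Diagram (L ++ (T ++ R)) Z} (h : LinFam D)
    (g : B.Piece S T) : LinFam fun f => Diagram.cons L R g (D f) := by
  obtain ⟨φ, hφ⟩ := h.eval
  have key : ∀ f, (Diagram.cons L R g (D f)).eval =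
      (Linear.leftComp K _ (B.addLeft L (B.addRight (g.eval B) R)) ∘ₗ φ) f := fun f => by
    simp [Diagram.eval, hφ]
  refine ⟨⟨_, key⟩, fun below above => LinList.append ?_ (h.cuts _ above)⟩
  refine linList_level _ _ _ (Linear.rightComp K _ (above ≫ below) ∘ₗ
    (Linear.leftComp K _ (B.addLeft L (B.addRight (g.eval B) R)) ∘ₗ φ)) fun f => ?_
  simp [key]

theorem LinFam.coupon {L R S T Z : Word I} (D : B.Diagram (L ++ (T ++ R)) Z)
    (φ : F →ₗ[K] (B.obj S ⟶ B.obj T)) :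
    LinFam fun f => Diagram.cons L R (.coupon S T (φ f)) D := by
  refine ⟨⟨Linear.rightComp K _ D.eval ∘ₗ B.layerLin L R S T ∘ₗ φ, fun f => rfl⟩,
    fun below above => LinList.append ?_ ?_⟩
  · refine linList_level _ _ _ (Linear.rightComp K _ (above ≫ below) ∘ₗ
      Linear.rightComp K _ D.eval ∘ₗ B.layerLin L R S T ∘ₗ φ) fun f => ?_
    exact Category.assoc _ _ _
  · exact linList_cutsAux_below D (Linear.leftComp K _ below ∘ₗ B.layerLin L R S T ∘ₗ φ) above

theorem LinFam.vertex {L R Z : Word I} {i j k : I} (D : B.Diagram (L ++ ([dn i, dn j, dn k] ++ R)) Z) :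
    LinFam fun x : B.H i j k => Diagram.cons L R (vertex x) D :=
  LinFam.coupon (S := []) D
    (Linear.rightComp K (𝟙_ C) (B.V i ◁ B.V j ◁ (ρ_ (B.V k)).inv) :
      B.H i j k →ₗ[K] (𝟙_ C ⟶ B.V i ⊗ (B.V j ⊗ (B.V k ⊗ 𝟙_ C))))

theorem LinFam.gPrime {D : F → B.Diagram [] []} (h : LinFam D) (I₀ : Set I) (d : I → K) :
    IsLinearMap K fun f => (D f).gPrime I₀ d := by
  classical
  obtain ⟨M, hM⟩ := h.cuts (𝟙 (𝟙_ C)) (𝟙 (𝟙_ C))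
  have hM : ∀ f, (D f).cuts = M.map fun p => (p.1, p.2 f) := hM
  have key : ∀ f, (D f).gPrime I₀ d =
      match M.find? (fun p => decide (p.1 ∈ I₀)) with
      | some p => d p.1 * p.2 f
      | none => 0 := by
    intro f
    unfold Diagram.gPrime
    rw [hM f, List.find?_map]
    have : ((fun p : I × K => decide (p.1 ∈ I₀)) ∘ fun p : I × (F →ₗ[K] K) => (p.1, p.2 f)) =
        fun p => decide (p.1 ∈ I₀) := rfl
    have e : M.find? ((fun p : I × K => @decide (p.1 ∈ I₀) (Classical.propDecidable _)) ∘
        fun p : I × (F →ₗ[K] K) => (p.1, p.2 f)) = M.find? (fun p => decide (p.1 ∈ I₀)) := by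
      congr 1
    rw [e]
    cases M.find? (fun p => decide (p.1 ∈ I₀)) <;> rfl
  constructor
  · intro f g
    simp only [key]
    cases M.find? (fun p => decide (p.1 ∈ I₀)) <;> simp [mul_add]
  · intro a f
    simp only [key]
    cases M.find? (fun p => decide (p.1 ∈ I₀)) <;> simp [mul_left_comm]


open TensorProduct

/-- The linear form on a tensor product of four modules given by a function of four variables
that is linear in each of them. -/
def lift₄ {M₁ M₂ M₃ M₄ : Type v} [AddCommGroup M₁] [AddCommGroup M₂] [AddCommGroup M₃]
    [AddCommGroup M₄] [Module K M₁] [Module K M₂] [Module K M₃] [Module K M₄]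
    (f : M₁ → M₂ → M₃ → M₄ → K)
    (h₁ : ∀ b c d, IsLinearMap K fun a => f a b c d)
    (h₂ : ∀ a c d, IsLinearMap K fun b => f a b c d)
    (h₃ : ∀ a b d, IsLinearMap K fun c => f a b c d)
    (h₄ : ∀ a b c, IsLinearMap K fun d => f a b c d) :
    Module.Dual K (M₁ ⊗[K] (M₂ ⊗[K] (M₃ ⊗[K] M₄))) :=
  TensorProduct.lift
    { toFun := fun a => TensorProduct.lift
        { toFun := fun b => TensorProduct.lift
            (LinearMap.mk₂ K (f a b) (fun c c' d => (h₃ a b d).1 c c')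
              (fun r c d => (h₃ a b d).2 r c) (fun c d d' => (h₄ a b c).1 d d')
              (fun r c d => (h₄ a b c).2 r d))
          map_add' := fun b b' => by
            refine TensorProduct.ext' fun c d => ?_
            simpa using (h₂ a c d).1 b b'
          map_smul' := fun r b => by
            refine TensorProduct.ext' fun c d => ?_
            simpa using (h₂ a c d).2 r b }
      map_add' := fun a a' => by
        refine TensorProduct.ext_threefold' fun b c d => ?_
        simpa using (h₁ b c d).1 a a'
      map_smul' := fun r a => by
        refine TensorProduct.ext_threefold' fun b c d => ?_
        simpa using (h₁ b c d).2 r a }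

theorem linFam_tetrahedron₁ {i j k l m n : I}
    (x₂ : B.H k l (B.star m)) (x₃ : B.H n (B.star l) (B.star j)) (x₄ : B.H m (B.star n) (B.star i)) :
    LinFam fun x₁ : B.H i j (B.star k) => tetrahedron x₁ x₂ x₃ x₄ := by
  delta tetrahedron
  repeat' first | exact LinFam.vertex _ | refine LinFam.cons ?_ _

theorem linFam_tetrahedron₂ {i j k l m n : I}
    (x₁ : B.H i j (B.star k)) (x₃ : B.H n (B.star l) (B.star j)) (x₄ : B.H m (B.star n) (B.star i)) :
    LinFam fun x₂ : B.H k l (B.star m) => tetrahedron x₁ x₂ x₃ x₄ := by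
  delta tetrahedron
  repeat' first | exact LinFam.vertex _ | refine LinFam.cons ?_ _

theorem linFam_tetrahedron₃ {i j k l m n : I}
    (x₁ : B.H i j (B.star k)) (x₂ : B.H k l (B.star m)) (x₄ : B.H m (B.star n) (B.star i)) :
    LinFam fun x₃ : B.H n (B.star l) (B.star j) => tetrahedron x₁ x₂ x₃ x₄ := by
  delta tetrahedron
  repeat' first | exact LinFam.vertex _ | refine LinFam.cons ?_ _

theorem linFam_tetrahedron₄ {i j k l m n : I}
    (x₁ : B.H i j (B.star k)) (x₂ : B.H k l (B.star m)) (x₃ : B.H n (B.star l) (B.star j)) :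
    LinFam fun x₄ : B.H m (B.star n) (B.star i) => tetrahedron x₁ x₂ x₃ x₄ := by
  delta tetrahedron
  exact LinFam.vertex _

theorem linFam_thetaGraph₁ {i j k : I} (y : B.H k (B.star j) (B.star i)) :
    LinFam fun x : B.H i j (B.star k) => thetaGraph x y := by
  delta thetaGraph
  repeat' first | exact LinFam.vertex _ | refine LinFam.cons ?_ _

theorem linFam_thetaGraph₂ {i j k : I} (x : B.H i j (B.star k)) :
    LinFam fun y : B.H k (B.star j) (B.star i) => thetaGraph x y := by
  delta thetaGraph
  exact LinFam.vertex _

variable (B)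

/-- The modified `6j`-symbol as a linear form on
`H(Γ) = H(i, j, k*) ⊗ H(k, l, m*) ⊗ H(n, l*, j*) ⊗ H(m, n*, i*)`. -/
def sixJ (I₀ : Set I) (d : I → K) (i j k l m n : I) :
    Module.Dual K (B.H i j (B.star k) ⊗[K] (B.H k l (B.star m) ⊗[K]
      (B.H n (B.star l) (B.star j) ⊗[K] B.H m (B.star n) (B.star i)))) :=
  lift₄ (fun x₁ x₂ x₃ x₄ => (tetrahedron x₁ x₂ x₃ x₄).gPrime I₀ d)
    (fun x₂ x₃ x₄ => (linFam_tetrahedron₁ x₂ x₃ x₄).gPrime I₀ d)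
    (fun x₁ x₃ x₄ => (linFam_tetrahedron₂ x₁ x₃ x₄).gPrime I₀ d)
    (fun x₁ x₂ x₄ => (linFam_tetrahedron₃ x₁ x₂ x₄).gPrime I₀ d)
    (fun x₁ x₂ x₃ => (linFam_tetrahedron₄ x₁ x₂ x₃).gPrime I₀ d)

theorem sixJ_tmul (I₀ : Set I) (d : I → K) {i j k l m n : I} (x₁ : B.H i j (B.star k))
    (x₂ : B.H k l (B.star m)) (x₃ : B.H n (B.star l) (B.star j))
    (x₄ : B.H m (B.star n) (B.star i)) :
    B.sixJ I₀ d i j k l m n (x₁ ⊗ₜ[K] (x₂ ⊗ₜ[K] (x₃ ⊗ₜ[K] x₄))) =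
      (tetrahedron x₁ x₂ x₃ x₄).gPrime I₀ d := rfl

/-- The pairing `H(i, j, k*) ⊗ H(k, j*, i*) → K`. -/
def pairing (I₀ : Set I) (d : I → K) (i j k : I) :
    B.H i j (B.star k) →ₗ[K] B.H k (B.star j) (B.star i) →ₗ[K] K :=
  LinearMap.mk₂ K (fun x y => (thetaGraph x y).gPrime I₀ d)
    (fun x x' y => ((linFam_thetaGraph₁ y).gPrime I₀ d).1 x x')
    (fun r x y => ((linFam_thetaGraph₁ y).gPrime I₀ d).2 r x)
    (fun x y y' => ((linFam_thetaGraph₂ x).gPrime I₀ d).1 y y')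
    (fun r x y => ((linFam_thetaGraph₂ x).gPrime I₀ d).2 r y)

theorem pairing_apply (I₀ : Set I) (d : I → K) {i j k : I} (x : B.H i j (B.star k))
    (y : B.H k (B.star j) (B.star i)) :
    B.pairing I₀ d i j k x y = (thetaGraph x y).gPrime I₀ d := rfl

/-- The map
`H(k, j*, i*) ⊗ H(m, l*, k*) ⊗ H(j, l, n*) ⊗ H(i, n, m*) → H(Γ)* = Hom_K(H(Γ), K)`
given by the pairings of the corresponding factors. -/
def toDual (I₀ : Set I) (d : I → K) (i j k l m n : I) :
    B.H k (B.star j) (B.star i) ⊗[K] (B.H m (B.star l) (B.star k) ⊗[K]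
      (B.H j l (B.star n) ⊗[K] B.H i n (B.star m))) →ₗ[K]
    Module.Dual K (B.H i j (B.star k) ⊗[K] (B.H k l (B.star m) ⊗[K]
      (B.H n (B.star l) (B.star j) ⊗[K] B.H m (B.star n) (B.star i)))) :=
  TensorProduct.dualDistrib K _ _ ∘ₗ TensorProduct.map (B.pairing I₀ d i j k).flip
    (TensorProduct.dualDistrib K _ _ ∘ₗ TensorProduct.map (B.pairing I₀ d k l m).flip
      (TensorProduct.dualDistrib K _ _ ∘ₗ TensorProduct.map (B.pairing I₀ d j l n)
        (B.pairing I₀ d i n m)))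

open Classical in
/-- The modified `6j`-symbol as an element of
`H(k, j*, i*) ⊗ H(m, l*, k*) ⊗ H(j, l, n*) ⊗ H(i, n, m*)`, when the pairings identify this module
with `H(Γ)*` (and zero by convention otherwise). -/
def sixJTensor (I₀ : Set I) (d : I → K) (i j k l m n : I) :
    B.H k (B.star j) (B.star i) ⊗[K] (B.H m (B.star l) (B.star k) ⊗[K]
      (B.H j l (B.star n) ⊗[K] B.H i n (B.star m))) :=
  if h : Function.Bijective (B.toDual I₀ d i j k l m n) then
    (LinearEquiv.ofBijective _ h).symm (B.sixJ I₀ d i j k l m n)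
  else 0

end Linearity

variable (B)

/-- The pair `(i, j)` is good: `V i ⊗ V j` is a finite direct sum of objects `V k` with `k ∈ I₀`
and `d k` invertible. -/
def IsGood (I₀ : Set I) (d : I → K) (i j : I) : Prop :=
  ∃ (n : ℕ) (c : Fin n → I), (∀ a, c a ∈ I₀ ∧ IsUnit (d (c a))) ∧
    ∃ b : Limits.Bicone fun a => B.V (c a), Nonempty b.IsBilimit ∧ Nonempty (B.V i ⊗ B.V j ≅ b.pt)

structure IsStronglyGood (I₀ : Set I) (d : I → K) (i j k l m n : I) : Prop where
  m_mem : m ∈ I₀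
  n_mem : n ∈ I₀
  ij : B.IsGood I₀ d i j
  jl : B.IsGood I₀ d j l
  i_n : B.IsGood I₀ d i n
  kl : B.IsGood I₀ d k l

/-- The indices `k` with `H^{ij}_k = Hom(V k, V i ⊗ V j) ≠ 0`. -/
def summands (i j : I) : Set I := {k | ∃ f : B.V k ⟶ B.V i ⊗ B.V j, f ≠ 0}

end BasicData

end Main

/-! Contractions of tensors -/

section Contraction

open TensorProduct

variable {K : Type w} [CommRing K]

section

variable {A A' M N : Type*} [AddCommGroup A] [AddCommGroup A'] [AddCommGroup M] [AddCommGroup N]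
  [Module K A] [Module K A'] [Module K M] [Module K N]

/-- The contraction `(a ⊗ x) ⊗ (a' ⊗ y) ↦ p(a, a') x ⊗ y` along a pairing `p`. -/
def contract (p : A →ₗ[K] A' →ₗ[K] K) : (A ⊗[K] M) ⊗[K] (A' ⊗[K] N) →ₗ[K] M ⊗[K] N :=
  (TensorProduct.lid K (M ⊗[K] N)).toLinearMap ∘ₗ
    TensorProduct.map (TensorProduct.lift p) LinearMap.id ∘ₗ
      (TensorProduct.tensorTensorTensorComm K A M A' N).toLinearMap

theorem contract_tmul (p : A →ₗ[K] A' →ₗ[K] K) (a : A) (a' : A') (x : M) (y : N) :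
    contract p ((a ⊗ₜ[K] x) ⊗ₜ[K] (a' ⊗ₜ[K] y)) = p a a' • (x ⊗ₜ[K] y) := rfl

end

section

variable {A₁ A₂ A₃ A₄ B₁ B₂ B₃ B₄ C₁ C₂ C₃ C₄ : Type v}
  [AddCommGroup A₁] [AddCommGroup A₂] [AddCommGroup A₃] [AddCommGroup A₄]
  [AddCommGroup B₁] [AddCommGroup B₂] [AddCommGroup B₃] [AddCommGroup B₄]
  [AddCommGroup C₁] [AddCommGroup C₂] [AddCommGroup C₃] [AddCommGroup C₄]
  [Module K A₁] [Module K A₂] [Module K A₃] [Module K A₄]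
  [Module K B₁] [Module K B₂] [Module K B₃] [Module K B₄]
  [Module K C₁] [Module K C₂] [Module K C₃] [Module K C₄]

/-- Reordering the four factors of a tensor. -/
def lastFirst : A₁ ⊗[K] (A₂ ⊗[K] (A₃ ⊗[K] A₄)) ≃ₗ[K] A₄ ⊗[K] (A₃ ⊗[K] (A₁ ⊗[K] A₂)) :=
  (TensorProduct.assoc K A₁ A₂ (A₃ ⊗[K] A₄)).symm ≪≫ₗ
    TensorProduct.comm K (A₁ ⊗[K] A₂) (A₃ ⊗[K] A₄) ≪≫ₗ
    TensorProduct.congr (TensorProduct.comm K A₃ A₄) (LinearEquiv.refl K _) ≪≫ₗ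
    TensorProduct.assoc K A₄ A₃ (A₁ ⊗[K] A₂)

/-- The contraction of three tensors with four factors along the pairings `r` of `A₄` with `B₁`,
`q` of `B₃` with `C₂`, and `p` of `A₃` with `C₁`. The remaining factors are put in the order
`A₂, A₁, B₂, B₄, C₄, C₃`. -/
def contract₃ (p : A₃ →ₗ[K] C₁ →ₗ[K] K) (q : B₃ →ₗ[K] C₂ →ₗ[K] K) (r : A₄ →ₗ[K] B₁ →ₗ[K] K) :
    ((A₁ ⊗[K] (A₂ ⊗[K] (A₃ ⊗[K] A₄))) ⊗[K] (B₁ ⊗[K] (B₂ ⊗[K] (B₃ ⊗[K] B₄)))) ⊗[K]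
      (C₁ ⊗[K] (C₂ ⊗[K] (C₃ ⊗[K] C₄))) →ₗ[K]
    ((A₂ ⊗[K] A₁) ⊗[K] (B₂ ⊗[K] B₄)) ⊗[K] (C₄ ⊗[K] C₃) :=
  TensorProduct.map
      (TensorProduct.map (TensorProduct.comm K A₁ A₂).toLinearMap LinearMap.id)
      (TensorProduct.comm K C₃ C₄).toLinearMap ∘ₗ
    contract q ∘ₗ contract p ∘ₗ
    TensorProduct.map
      ((TensorProduct.assoc K A₃ B₃ ((A₁ ⊗[K] A₂) ⊗[K] (B₂ ⊗[K] B₄))).toLinearMap ∘ₗ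
        (TensorProduct.tensorTensorTensorComm K A₃ (A₁ ⊗[K] A₂) B₃ (B₂ ⊗[K] B₄)).toLinearMap ∘ₗ
        contract r ∘ₗ
        TensorProduct.map lastFirst.toLinearMap
          (TensorProduct.map LinearMap.id (TensorProduct.leftComm K B₂ B₃ B₄).toLinearMap))
      LinearMap.id

theorem contract₃_tmul (p : A₃ →ₗ[K] C₁ →ₗ[K] K) (q : B₃ →ₗ[K] C₂ →ₗ[K] K)
    (r : A₄ →ₗ[K] B₁ →ₗ[K] K) (a₁ : A₁) (a₂ : A₂) (a₃ : A₃) (a₄ : A₄) (b₁ : B₁) (b₂ : B₂)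
    (b₃ : B₃) (b₄ : B₄) (c₁ : C₁) (c₂ : C₂) (c₃ : C₃) (c₄ : C₄) :
    contract₃ p q r (((a₁ ⊗ₜ[K] (a₂ ⊗ₜ[K] (a₃ ⊗ₜ[K] a₄))) ⊗ₜ[K]
        (b₁ ⊗ₜ[K] (b₂ ⊗ₜ[K] (b₃ ⊗ₜ[K] b₄)))) ⊗ₜ[K] (c₁ ⊗ₜ[K] (c₂ ⊗ₜ[K] (c₃ ⊗ₜ[K] c₄)))) =
      (p a₃ c₁ * q b₃ c₂ * r a₄ b₁) •
        (((a₂ ⊗ₜ[K] a₁) ⊗ₜ[K] (b₂ ⊗ₜ[K] b₄)) ⊗ₜ[K] (c₄ ⊗ₜ[K] c₃)) := by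
  simp [contract₃, lastFirst, contract_tmul, TensorProduct.smul_tmul']
  ring_nf

/-- The contraction of two tensors with four factors along the pairing `s` of `A₄` with `B₂`.
The remaining factors are put in the order `A₁, B₁, A₂, B₄, B₃, A₃`. -/
def contract₁ (s : A₄ →ₗ[K] B₂ →ₗ[K] K) :
    (A₁ ⊗[K] (A₂ ⊗[K] (A₃ ⊗[K] A₄))) ⊗[K] (B₁ ⊗[K] (B₂ ⊗[K] (B₃ ⊗[K] B₄))) →ₗ[K]
    ((A₁ ⊗[K] B₁) ⊗[K] (A₂ ⊗[K] B₄)) ⊗[K] (B₃ ⊗[K] A₃) :=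
  TensorProduct.map (TensorProduct.tensorTensorTensorComm K A₁ A₂ B₁ B₄).toLinearMap
      (TensorProduct.comm K A₃ B₃).toLinearMap ∘ₗ
    (TensorProduct.tensorTensorTensorComm K (A₁ ⊗[K] A₂) A₃ (B₁ ⊗[K] B₄) B₃).toLinearMap ∘ₗ
    TensorProduct.map (TensorProduct.comm K A₃ (A₁ ⊗[K] A₂)).toLinearMap
      ((TensorProduct.assoc K B₁ B₄ B₃).symm.toLinearMap ∘ₗ
        TensorProduct.map LinearMap.id (TensorProduct.comm K B₃ B₄).toLinearMap) ∘ₗ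
    contract s ∘ₗ
    TensorProduct.map lastFirst.toLinearMap
      (TensorProduct.leftComm K B₁ B₂ (B₃ ⊗[K] B₄)).toLinearMap

theorem contract₁_tmul (s : A₄ →ₗ[K] B₂ →ₗ[K] K) (a₁ : A₁) (a₂ : A₂) (a₃ : A₃) (a₄ : A₄)
    (b₁ : B₁) (b₂ : B₂) (b₃ : B₃) (b₄ : B₄) :
    contract₁ s ((a₁ ⊗ₜ[K] (a₂ ⊗ₜ[K] (a₃ ⊗ₜ[K] a₄))) ⊗ₜ[K]
        (b₁ ⊗ₜ[K] (b₂ ⊗ₜ[K] (b₃ ⊗ₜ[K] b₄)))) =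
      s a₄ b₂ • (((a₁ ⊗ₜ[K] b₁) ⊗ₜ[K] (a₂ ⊗ₜ[K] b₄)) ⊗ₜ[K] (b₃ ⊗ₜ[K] a₃)) := by
  simp [contract₁, lastFirst, contract_tmul]

end

end Contraction

end

end ModifiedSixJ

open CategoryTheory MonoidalCategory

/-! Bending legs identifies `H i j (star k)` with Hom(V_k, V_i ⊗ V_j) and `H k (star j) (star i)`
with Hom(V_i ⊗ V_j, V_k). Cut at the first leg of its lowest vertex, the theta graph becomes a
composite V_k ⟶ V_i ⊗ V_j ⟶ V_k, so the pairing is d(k) times the scalar of that composite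
(`gPrime_thetaGraph`). The tetrahedron becomes d(m) times the scalar of V_m ⟶ V_k ⊗ V_l ⟶ (V_i ⊗
V_j) ⊗ V_l ≅ V_i ⊗ (V_j ⊗ V_l) ⟶ V_i ⊗ V_n ⟶ V_m (`gPrime_tetrahedron`). This is where the pivotal
structure enters: closing strands on a side must give these composites exactly.

If (i, j) is good, a decomposition of V_i ⊗ V_j, together with Schur's lemma as built into the basic
data, gives finite dual families for every pairing of `H i j (star k)` (`IsGood.hasDualFamily`).
They need not be bases, but they suffice to make the pairings and their tensor products perfect.
They also resolve the identity: the sum over k of d(k) ∑ₐ (out)ₐ ≫ (in)ₐ is the identity of V_i ⊗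
V_j (`sum_bendOut_bendIn`).

By perfectness, the identity may be tested by pairing both sides with six vectors. A contraction
then becomes a sum over dual families, and such a sum glues two tetrahedra along a vertex. On the
left, two of the three contractions rebuild composites, and the third, weighted by d(j) and summed
over j, inserts the identity of V_{j₂} ⊗ V_{j₃}. On the right, the single contraction glues along
(j₅, j₈, j₀). Both sides reduce to d(j₀) times the scalar of one endomorphism of V_{j₀}, which
splits off j₄, j₃, j₂ successively and then fuses them in the other bracketing; the difference is
coherence and interchange. If j₆ ∉ I₀, goodness of (j₅, j₃) forces `H j₅ j₃ (star j₆)` to vanish,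
and both sides are zero. -/

namespace ModifiedSixJ

/-! ### Duality calculus and partial traces in a pivotal category -/

section PivotalLemmas

universe v u

variable {C : Type u} [Category.{v} C] [MonoidalCategory C]

section TwoSided

variable [TwoSidedDuality C]

theorem coevL_evL (V : C) :
    coevL V ▷ V ≫ (α_ V (dual V) V).hom ≫ V ◁ evL V = (λ_ V).hom ≫ (ρ_ V).inv :=
  (TwoSidedDuality.left V).evaluation_coevaluation'

theorem coevL_evL_dual (V : C) :
    dual V ◁ coevL V ≫ (α_ (dual V) V (dual V)).inv ≫ evL V ▷ dual V =
      (ρ_ (dual V)).hom ≫ (λ_ (dual V)).inv :=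
  (TwoSidedDuality.left V).coevaluation_evaluation'

theorem coevR_evR (V : C) :
    V ◁ coevR V ≫ (α_ V (dual V) V).inv ≫ evR V ▷ V = (ρ_ V).hom ≫ (λ_ V).inv :=
  (TwoSidedDuality.right V).coevaluation_evaluation'

theorem coevR_evR_dual (V : C) :
    coevR V ▷ dual V ≫ (α_ (dual V) V (dual V)).hom ≫ dual V ◁ evR V =
      (λ_ (dual V)).hom ≫ (ρ_ (dual V)).inv :=
  (TwoSidedDuality.right V).evaluation_coevaluation'

/-- A zigzag undoes the evaluation. Consequently morphisms into a dual may be compared after pairing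
with `V`, the method used for most equations below. -/
theorem whiskerRight_evL_recover {V X : C} (f : X ⟶ dual V) :
    f = (ρ_ X).inv ≫ X ◁ coevL V ≫ (α_ X V (dual V)).inv ≫ (f ▷ V ≫ evL V) ▷ dual V ≫
      (λ_ (dual V)).hom := by
  have h := coevL_evL_dual V
  calc f = (ρ_ X).inv ≫ f ▷ 𝟙_ C ≫ (dual V ◁ coevL V ≫ (α_ (dual V) V (dual V)).inv ≫
        evL V ▷ dual V) ≫ (λ_ (dual V)).hom := by rw [h]; simp
    _ = _ := by
      simp only [Category.assoc]
      rw [← whisker_exchange_assoc]; simp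

theorem evL_injective {V X : C} {f g : X ⟶ dual V} (h : f ▷ V ≫ evL V = g ▷ V ≫ evL V) :
    f = g := by
  rw [whiskerRight_evL_recover f, h, ← whiskerRight_evL_recover]

theorem whiskerLeft_evR_recover {V X : C} (f : X ⟶ dual V) :
    f = (λ_ X).inv ≫ coevR V ▷ X ≫ (α_ (dual V) V X).hom ≫ dual V ◁ (V ◁ f ≫ evR V) ≫
      (ρ_ (dual V)).hom := by
  have h := coevR_evR_dual V
  calc f = (λ_ X).inv ≫ 𝟙_ C ◁ f ≫ (coevR V ▷ dual V ≫ (α_ (dual V) V (dual V)).hom ≫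
        dual V ◁ evR V) ≫ (ρ_ (dual V)).hom := by rw [h]; simp
    _ = _ := by
      simp only [Category.assoc]
      rw [whisker_exchange_assoc]; simp

theorem evR_injective {V X : C} {f g : X ⟶ dual V} (h : V ◁ f ≫ evR V = V ◁ g ≫ evR V) :
    f = g := by
  rw [whiskerLeft_evR_recover f, h, ← whiskerLeft_evR_recover]

/-- The morphism into `dual V` corresponding to a pairing `X ⊗ V ⟶ 𝟙`. -/
theorem exists_evL {V X : C} (p : X ⊗ V ⟶ 𝟙_ C) : ∃ f : X ⟶ dual V, f ▷ V ≫ evL V = p := by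
  refine ⟨(ρ_ X).inv ≫ X ◁ coevL V ≫ (α_ X V (dual V)).inv ≫ p ▷ dual V ≫ (λ_ (dual V)).hom, ?_⟩
  have h := coevL_evL V
  calc _ = 𝟙 _ ⊗≫ X ◁ coevL V ▷ V ⊗≫ (p ▷ (dual V ⊗ V) ≫ 𝟙_ C ◁ evL V) ⊗≫ 𝟙 _ := by monoidal
    _ = 𝟙 _ ⊗≫ X ◁ (coevL V ▷ V ≫ (α_ V (dual V) V).hom ≫ V ◁ evL V) ⊗≫ p ⊗≫ 𝟙 _ := by
      rw [← whisker_exchange]; monoidal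
    _ = p := by rw [h]; monoidal

theorem exists_evR {V X : C} (p : V ⊗ X ⟶ 𝟙_ C) : ∃ f : X ⟶ dual V, V ◁ f ≫ evR V = p := by
  refine ⟨(λ_ X).inv ≫ coevR V ▷ X ≫ (α_ (dual V) V X).hom ≫ dual V ◁ p ≫ (ρ_ (dual V)).hom, ?_⟩
  have h := coevR_evR V
  calc _ = 𝟙 _ ⊗≫ V ◁ coevR V ▷ X ⊗≫ ((V ⊗ dual V) ◁ p ≫ evR V ▷ 𝟙_ C) ⊗≫ 𝟙 _ := by monoidal
    _ = 𝟙 _ ⊗≫ (V ◁ coevR V ≫ (α_ V (dual V) V).inv ≫ evR V ▷ V) ▷ X ⊗≫ p ⊗≫ 𝟙 _ := by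
      rw [whisker_exchange]; monoidal
    _ = p := by rw [h]; monoidal

theorem transposeL_evL {V W : C} (f : V ⟶ W) :
    transposeL f ▷ V ≫ evL V = dual W ◁ f ≫ evL W := by
  obtain ⟨g, hg⟩ := exists_evL (dual W ◁ f ≫ evL W)
  rw [← hg]
  congr 2
  rw [whiskerRight_evL_recover g, hg]
  simp [transposeL]

theorem transposeR_evR {V W : C} (f : V ⟶ W) :
    V ◁ transposeR f ≫ evR V = f ▷ dual W ≫ evR W := by
  obtain ⟨g, hg⟩ := exists_evR (f ▷ dual W ≫ evR W)
  rw [← hg]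
  congr 2
  rw [whiskerLeft_evR_recover g, hg]
  simp [transposeR]

theorem gammaL_evL (V W : C) :
    gammaL V W ▷ (V ⊗ W) ≫ evL (V ⊗ W) = 𝟙 _ ⊗≫ dual W ◁ evL V ▷ W ⊗≫ evL W := by
  obtain ⟨g, hg⟩ := exists_evL (𝟙 _ ⊗≫ dual W ◁ evL V ▷ W ⊗≫ evL W :
    (dual W ⊗ dual V) ⊗ (V ⊗ W) ⟶ 𝟙_ C)
  rw [← hg]
  congr 2
  rw [whiskerRight_evL_recover g, hg, gammaL]
  monoidal

theorem gammaR_evR (V W : C) :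
    (V ⊗ W) ◁ gammaR V W ≫ evR (V ⊗ W) = 𝟙 _ ⊗≫ V ◁ evR W ▷ dual V ⊗≫ evR V := by
  obtain ⟨g, hg⟩ := exists_evR (𝟙 _ ⊗≫ V ◁ evR W ▷ dual V ⊗≫ evR V :
    (V ⊗ W) ⊗ (dual W ⊗ dual V) ⟶ 𝟙_ C)
  rw [← hg]
  congr 2
  rw [whiskerLeft_evR_recover g, hg, gammaR]
  monoidal

end TwoSided

variable [PivotalCategory C]

/-- The pivotal axiom in use: a morphism built from the left duality passes through the right cap.
-/
theorem transposeL_evR {V W : C} (f : V ⟶ W) :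
    V ◁ transposeL f ≫ evR V = f ▷ dual W ≫ evR W := by
  rw [PivotalCategory.transpose_eq, transposeR_evR]

theorem gammaL_evR (V W : C) :
    (V ⊗ W) ◁ gammaL V W ≫ evR (V ⊗ W) = 𝟙 _ ⊗≫ V ◁ evR W ▷ dual V ⊗≫ evR V := by
  rw [PivotalCategory.gamma_eq, gammaR_evR]

variable (C) in
/-- The two canonical morphisms from the dual of the unit to the unit agree. -/
theorem evL_unit_eq_evR_unit :
    (ρ_ (dual (𝟙_ C))).inv ≫ evL (𝟙_ C) = (λ_ (dual (𝟙_ C))).inv ≫ evR (𝟙_ C) := by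
  set l : dual (𝟙_ C) ⟶ 𝟙_ C := (ρ_ (dual (𝟙_ C))).inv ≫ evL (𝟙_ C) with hl
  set r : dual (𝟙_ C) ⟶ 𝟙_ C := (λ_ (dual (𝟙_ C))).inv ≫ evR (𝟙_ C) with hr
  have hl' : evL (𝟙_ C) = (ρ_ _).hom ≫ l := by simp [hl]
  have hr' : evR (𝟙_ C) = (λ_ _).hom ≫ r := by simp [hr]
  obtain ⟨l', hl₁⟩ := exists_evL (V := 𝟙_ C) (X := 𝟙_ C) (λ_ _).hom
  have hl₂ : l' ≫ l = 𝟙 _ := by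
    rw [hl, rightUnitor_inv_naturality_assoc, hl₁]; simp [unitors_equal]
  have hl₃ : l ≫ l' = 𝟙 _ := by
    apply evL_injective
    rw [hl']
    simp [hl₂]
  obtain ⟨r', hr₁⟩ := exists_evR (V := 𝟙_ C) (X := 𝟙_ C) (λ_ _).hom
  have hr₂ : r' ≫ r = 𝟙 _ := by
    rw [hr, leftUnitor_inv_naturality_assoc, hr₁]; simp
  have hr₃ : r ≫ r' = 𝟙 _ := by
    apply evR_injective
    rw [hr']
    simp [hr₂]
  have : IsIso l := ⟨l', hl₃, hl₂⟩
  have : IsIso r := ⟨r', hr₃, hr₂⟩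
  -- `s` is the comparison 𝟙* ⊗ 𝟙* ⟶ (𝟙 ⊗ 𝟙)* followed by (𝟙 ⊗ 𝟙)* ≅ 𝟙*. Both dualities give the
  -- same `s`, so `l` and `r` are multiplicative for it: `s ≫ l` is l ⊗ l and `s ≫ r` is r ⊗ r.
  obtain ⟨s, hs⟩ : ∃ s : dual (𝟙_ C) ⊗ dual (𝟙_ C) ⟶ dual (𝟙_ C),
      s ≫ transposeL (λ_ (𝟙_ C)).hom = gammaL (𝟙_ C) (𝟙_ C) := by
    refine ⟨gammaL (𝟙_ C) (𝟙_ C) ≫ transposeL (λ_ (𝟙_ C)).inv, ?_⟩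
    apply evL_injective
    rw [comp_whiskerRight_assoc, transposeL_evL, comp_whiskerRight_assoc,
      ← whisker_exchange_assoc, transposeL_evL]
    simp
  have h₁ : s ≫ l = dual (𝟙_ C) ◁ l ≫ (ρ_ _).hom ≫ l := by
    have h := gammaL_evL (𝟙_ C) (𝟙_ C)
    rw [← hs, comp_whiskerRight_assoc, transposeL_evL, hl'] at h
    calc s ≫ l = 𝟙 _ ⊗≫ (s ▷ (𝟙_ C ⊗ 𝟙_ C) ≫ dual (𝟙_ C) ◁ (λ_ (𝟙_ C)).hom ≫
          (ρ_ (dual (𝟙_ C))).hom ≫ l) := by monoidal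
      _ = _ := by rw [h]; monoidal
  have h₂ : s ≫ r = r ▷ dual (𝟙_ C) ≫ (λ_ _).hom ≫ r := by
    have h := gammaL_evR (𝟙_ C) (𝟙_ C)
    rw [← hs, whiskerLeft_comp_assoc, transposeL_evR, hr'] at h
    calc s ≫ r = 𝟙 _ ⊗≫ ((𝟙_ C ⊗ 𝟙_ C) ◁ s ≫ (λ_ (𝟙_ C)).hom ▷ dual (𝟙_ C) ≫
          (λ_ (dual (𝟙_ C))).hom ≫ r) := by monoidal
      _ = _ := by rw [h]; monoidal
  have h₃ : dual (𝟙_ C) ◁ l ≫ (ρ_ _).hom ≫ l = l ▷ dual (𝟙_ C) ≫ (λ_ _).hom ≫ l := by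
    calc _ = dual (𝟙_ C) ◁ l ≫ l ▷ 𝟙_ C ≫ (ρ_ _).hom := by monoidal
      _ = l ▷ dual (𝟙_ C) ≫ 𝟙_ C ◁ l ≫ (ρ_ _).hom := by rw [whisker_exchange_assoc]
      _ = _ := by monoidal
  -- Following l ⊗ l = `s ≫ l` by l⁻¹ ≫ r gives l ⊗ r = `s ≫ r` = r ⊗ r. Cancelling the invertible
  -- second factor leaves l = r.
  have h₄ : l ▷ dual (𝟙_ C) ≫ (λ_ _).hom ≫ r = r ▷ dual (𝟙_ C) ≫ (λ_ _).hom ≫ r := by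
    have e : r = l ≫ l' ≫ r := by rw [← Category.assoc, hl₃, Category.id_comp]
    calc l ▷ dual (𝟙_ C) ≫ (λ_ _).hom ≫ r
        = (l ▷ dual (𝟙_ C) ≫ (λ_ _).hom ≫ l) ≫ l' ≫ r := by
          simp only [Category.assoc]; rw [← e]
      _ = r ▷ dual (𝟙_ C) ≫ (λ_ _).hom ≫ r := by
          rw [← h₃, ← h₁, Category.assoc, ← e, h₂]
  have h₅ : l ▷ dual (𝟙_ C) = r ▷ dual (𝟙_ C) := (cancel_mono ((λ_ _).hom ≫ r)).1 h₄
  have h₆ : l ▷ 𝟙_ C = r ▷ 𝟙_ C := by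
    rw [← cancel_epi (dual (𝟙_ C) ◁ l), whisker_exchange, whisker_exchange, h₅]
  exact (cancel_epi (ρ_ _).hom).1 (by
    rw [← rightUnitor_naturality, ← rightUnitor_naturality, h₆])

/-- Rotating a cup by `2π`. -/
theorem coevL_evR_evR (A : C) :
    dual A ◁ ((ρ_ A).inv ≫ A ◁ coevL (dual A) ≫ (α_ A (dual A) (dual (dual A))).inv ≫
      evR A ▷ dual (dual A) ≫ (λ_ _).hom) ≫ evR (dual A) = evL A := by
  obtain ⟨l', hl₁⟩ := exists_evL (V := 𝟙_ C) (X := 𝟙_ C) (λ_ _).hom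
  have hr₁ : 𝟙_ C ◁ l' ≫ evR (𝟙_ C) = (λ_ _).hom := by
    have h' : evR (𝟙_ C) = (λ_ _).hom ≫ (ρ_ _).inv ≫ evL (𝟙_ C) := by
      rw [evL_unit_eq_evR_unit]; simp
    rw [h', leftUnitor_naturality_assoc, rightUnitor_inv_naturality_assoc, hl₁]
    simp [unitors_equal]
  set l : dual (𝟙_ C) ⟶ 𝟙_ C := (ρ_ (dual (𝟙_ C))).inv ≫ evL (𝟙_ C) with hl
  -- Up to 𝟙* ≅ 𝟙 and the comparison into (A* ⊗ A)*, the left cup of A* is the left transpose of the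
  -- left cap of A. Equality of the two transposes then allows evaluation by right caps.
  have ht : (l ≫ coevL (dual A)) ≫ gammaL (dual A) A = transposeL (evL A) := by
    apply evL_injective
    have h₁ := coevL_evL (dual A)
    rw [transposeL_evL, comp_whiskerRight_assoc, gammaL_evL]
    calc _ = 𝟙 _ ⊗≫ l ▷ (dual A ⊗ A) ⊗≫ (coevL (dual A) ▷ dual A ≫
          (α_ (dual A) (dual (dual A)) (dual A)).hom ≫ dual A ◁ evL (dual A)) ▷ A ⊗≫ evL A := by
          monoidal
      _ = l ▷ (dual A ⊗ A) ≫ 𝟙_ C ◁ evL A ≫ (ρ_ _).hom := by rw [h₁]; monoidal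
      _ = dual (𝟙_ C) ◁ evL A ≫ (l ▷ 𝟙_ C ≫ (ρ_ _).hom) := by rw [whisker_exchange_assoc]
      _ = _ := by rw [rightUnitor_naturality, hl]; simp
  have hc : l' ≫ l = 𝟙 _ := by
    rw [hl, rightUnitor_inv_naturality_assoc, hl₁]; simp [unitors_equal]
  have h := transposeL_evR (evL A)
  rw [← ht, whiskerLeft_comp_assoc, gammaL_evR] at h
  calc _ = 𝟙 _ ⊗≫ (dual A ⊗ A) ◁ ((l' ≫ l) ≫ coevL (dual A)) ⊗≫ dual A ◁ evR A ▷ dual (dual A) ⊗≫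
        evR (dual A) := by rw [hc]; monoidal
    _ = 𝟙 _ ⊗≫ (dual A ⊗ A) ◁ l' ⊗≫ ((dual A ⊗ A) ◁ (l ≫ coevL (dual A)) ≫ (𝟙 _ ⊗≫
          dual A ◁ evR A ▷ dual (dual A) ⊗≫ evR (dual A))) := by monoidal
    _ = 𝟙 _ ⊗≫ ((dual A ⊗ A) ◁ l' ≫ evL A ▷ dual (𝟙_ C)) ≫ evR (𝟙_ C) := by
        rw [h]; monoidal
    _ = 𝟙 _ ⊗≫ evL A ▷ 𝟙_ C ≫ (𝟙_ C ◁ l' ≫ evR (𝟙_ C)) := by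
        rw [whisker_exchange]; monoidal
    _ = _ := by rw [hr₁]; monoidal

/-- The loop coloured by the unit has a right cup and a left cap. It is trivial because the two caps
agree on the unit, after which a zigzag applies. It serves cuts with nothing on their left. -/
theorem leftTrace_unit {A B : C} (f : A ⟶ B) :
    leftTrace (𝟙_ C) ((λ_ A).hom ≫ f ≫ (λ_ B).inv) = f := by
  have h₀ : coevR (𝟙_ C) ≫ evL (𝟙_ C) = 𝟙 _ := by
    have h := coevR_evR (𝟙_ C)
    have h' : evL (𝟙_ C) = (ρ_ _).hom ≫ (λ_ _).inv ≫ evR (𝟙_ C) := by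
      rw [← evL_unit_eq_evR_unit]; simp
    rw [h']
    calc _ = 𝟙 _ ⊗≫ (𝟙_ C ◁ coevR (𝟙_ C) ≫ (α_ (𝟙_ C) (dual (𝟙_ C)) (𝟙_ C)).inv ≫
          evR (𝟙_ C) ▷ 𝟙_ C) ⊗≫ 𝟙 _ := by monoidal
      _ = 𝟙 _ := by rw [h]; monoidal
  simp only [leftTrace]
  calc _ = 𝟙 _ ⊗≫ coevR (𝟙_ C) ▷ A ⊗≫ ((dual (𝟙_ C) ⊗ 𝟙_ C) ◁ f ≫ evL (𝟙_ C) ▷ B) ⊗≫ 𝟙 _ := by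
        monoidal
    _ = 𝟙 _ ⊗≫ (coevR (𝟙_ C) ≫ evL (𝟙_ C)) ▷ A ⊗≫ f := by
        rw [whisker_exchange]; monoidal
    _ = f := by rw [h₀]; monoidal

/-- The morphism `g` slides around the closed strand: across the left cup it becomes its left
transpose, which the right cap turns back into `g` because the two transposes agree. -/
theorem rightTrace_comp_whiskerLeft {Y Y' A B : C} (f : A ⊗ Y ⟶ B ⊗ Y') (g : Y' ⟶ Y) :
    rightTrace Y (f ≫ B ◁ g) = rightTrace Y' (A ◁ g ≫ f) := by
  have h : coevL Y' ≫ g ▷ dual Y' = coevL Y ≫ Y ◁ transposeL g := by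
    calc _ = 𝟙 _ ⊗≫ (coevL Y' ≫ g ▷ dual Y') ⊗≫ 𝟙 _ := by monoidal
      _ = 𝟙 _ ⊗≫ (coevL Y ▷ (𝟙_ C) ≫ (Y ⊗ dual Y) ◁ (coevL Y' ≫ g ▷ dual Y')) ⊗≫
          Y ◁ (evL Y ▷ dual Y') ⊗≫ 𝟙 _ := by
        rw [← whisker_exchange]
        have h₂ := coevL_evL Y
        calc _ = 𝟙 _ ⊗≫ (coevL Y' ≫ g ▷ dual Y') ⊗≫ ((λ_ Y).hom ≫ (ρ_ Y).inv) ▷ dual Y' ⊗≫ 𝟙 _ := by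
              monoidal
          _ = _ := by rw [← h₂]; monoidal
      _ = 𝟙 _ ⊗≫ coevL Y ⊗≫ Y ◁ dual Y ◁ coevL Y' ⊗≫
          Y ◁ ((dual Y ◁ g ≫ evL Y) ▷ dual Y') ⊗≫ 𝟙 _ := by monoidal
      _ = _ := by rw [transposeL]; monoidal
  have h' := transposeL_evR g
  simp only [rightTrace]
  calc _ = 𝟙 _ ⊗≫ (A ◁ coevL Y) ⊗≫ f ▷ dual Y ⊗≫ B ◁ (g ▷ dual Y ≫ evR Y) ⊗≫ 𝟙 _ := by monoidal
    _ = 𝟙 _ ⊗≫ (A ◁ coevL Y) ⊗≫ (f ▷ dual Y ≫ (B ⊗ Y') ◁ transposeL g) ⊗≫ B ◁ evR Y' ⊗≫ 𝟙 _ := by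
      rw [← h']; monoidal
    _ = 𝟙 _ ⊗≫ (A ◁ (coevL Y ≫ Y ◁ transposeL g)) ⊗≫ f ▷ dual Y' ⊗≫ B ◁ evR Y' ⊗≫ 𝟙 _ := by
      rw [← whisker_exchange]; monoidal
    _ = _ := by rw [← h]; monoidal

/-- Straightening the curl leaves a bent strand A ⟶ A** followed by a right cap; by `coevL_evR_evR`
this is the left zigzag. -/
theorem rightTrace_evR_coevL (A : C) : rightTrace (dual A) (evR A ≫ coevL A) = 𝟙 A := by
  have h := coevL_evL A
  rw [← coevL_evR_evR] at h
  simp only [rightTrace]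
  obtain ⟨p, hp⟩ : ∃ p, p = (ρ_ A).inv ≫ A ◁ coevL (dual A) ≫
    (α_ A (dual A) (dual (dual A))).inv ≫ evR A ▷ dual (dual A) ≫ (λ_ _).hom := ⟨_, rfl⟩
  rw [← hp] at h
  calc _ = p ≫ (λ_ _).inv ≫ coevL A ▷ dual (dual A) ⊗≫ A ◁ evR (dual A) ≫ (ρ_ A).hom := by
        rw [hp]; monoidal
    _ = (λ_ _).inv ≫ (𝟙_ C ◁ p ≫ coevL A ▷ dual (dual A)) ⊗≫ A ◁ evR (dual A) ≫ (ρ_ A).hom := by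
        monoidal
    _ = (λ_ _).inv ≫ (coevL A ▷ A ≫ (α_ A (dual A) A).hom ≫ A ◁ (dual A ◁ p ≫ evR (dual A))) ≫
        (ρ_ A).hom := by rw [whisker_exchange]; monoidal
    _ = _ := by rw [h]; simp

theorem rightTrace_whiskerRight_comp {Y A B A' B' : C} (f : A' ⟶ A) (h : A ⊗ Y ⟶ B ⊗ Y)
    (g : B ⟶ B') : rightTrace Y (f ▷ Y ≫ h ≫ g ▷ Y) = f ≫ rightTrace Y h ≫ g := by
  simp only [rightTrace]
  calc _ = 𝟙 _ ⊗≫ (A' ◁ coevL Y ≫ f ▷ (Y ⊗ dual Y)) ⊗≫ h ▷ dual Y ⊗≫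
        (g ▷ (Y ⊗ dual Y) ≫ B' ◁ evR Y) ⊗≫ 𝟙 _ := by monoidal
    _ = _ := by rw [whisker_exchange f (coevL Y), ← whisker_exchange g (evR Y)]; monoidal

/-- The trace of a theta-shaped diagram as a composition of two bent morphisms. -/
theorem rightTrace_theta {V W A Y : C} (u : W ⟶ dual V) (a : Y ⟶ dual A)
    (x : 𝟙_ C ⟶ A ⊗ W) (y : 𝟙_ C ⟶ V ⊗ Y) :
    rightTrace Y ((𝟙 (V ⊗ Y) ⊗≫ V ◁ Y ◁ x ⊗≫ V ◁ (a ▷ A ≫ evL A) ▷ W ⊗≫ V ◁ u ≫ evR V) ≫ y) =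
      ((λ_ V).inv ≫ x ▷ V ⊗≫ A ◁ (u ▷ V ≫ evL V) ≫ (ρ_ A).hom) ≫
        (λ_ A).inv ≫ y ▷ A ⊗≫ V ◁ (a ▷ A ≫ evL A) ≫ (ρ_ V).hom := by
  obtain ⟨f, hf⟩ : ∃ f, f = (λ_ V).inv ≫ x ▷ V ⊗≫ A ◁ (u ▷ V ≫ evL V) ≫ (ρ_ A).hom := ⟨_, rfl⟩
  obtain ⟨g, hg⟩ : ∃ g, g = (λ_ A).inv ≫ y ▷ A ⊗≫ V ◁ (a ▷ A ≫ evL A) ≫ (ρ_ V).hom := ⟨_, rfl⟩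
  -- The cap part is the right pairing of `a` with the transpose of `f`; this is checked with left
  -- caps, then transferred by `transposeL_evR`.
  have hx : (𝟙 (V ⊗ Y) ⊗≫ V ◁ Y ◁ x ⊗≫ V ◁ (a ▷ A ≫ evL A) ▷ W ⊗≫ V ◁ u ≫ evR V) =
      V ◁ a ≫ f ▷ dual A ≫ evR A := by
    have hq : (𝟙 Y ⊗≫ Y ◁ x ⊗≫ (a ▷ A ≫ evL A) ▷ W ⊗≫ u : Y ⟶ dual V) =
        a ≫ transposeL f := by
      apply evL_injective
      rw [comp_whiskerRight_assoc, transposeL_evL, ← whisker_exchange_assoc]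
      generalize a ▷ A ≫ evL A = e
      calc _ = 𝟙 _ ⊗≫ Y ◁ x ▷ V ⊗≫ (e ▷ (W ⊗ V) ≫ 𝟙_ C ◁ (u ▷ V ≫ evL V)) ⊗≫ 𝟙 _ := by monoidal
        _ = 𝟙 _ ⊗≫ Y ◁ ((λ_ V).inv ≫ x ▷ V ⊗≫ A ◁ (u ▷ V ≫ evL V) ≫ (ρ_ A).hom) ≫ e := by
          rw [← whisker_exchange]; monoidal
        _ = _ := by rw [← hf]; monoidal
    rw [← transposeL_evR, ← whiskerLeft_comp_assoc, ← hq]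
    monoidal
  have hy : y ≫ V ◁ a = coevL A ≫ g ▷ dual A := by
    rw [hg]
    conv_lhs => rw [whiskerRight_evL_recover a]
    generalize a ▷ A ≫ evL A = e
    calc _ = 𝟙 _ ⊗≫ (y ▷ 𝟙_ C ≫ (V ⊗ Y) ◁ coevL A) ⊗≫ V ◁ e ▷ dual A ⊗≫ 𝟙 _ := by monoidal
      _ = _ := by rw [← whisker_exchange]; monoidal
  -- Cyclicity carries `a` around the loop to `y`, which turns into a cup of `A` followed by `g`.
  -- What stays inside the trace is the curl of `rightTrace_evR_coevL`.
  rw [hx, Category.assoc, ← rightTrace_comp_whiskerLeft, ← hf, ← hg]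
  simp only [Category.assoc]
  rw [hy, ← Category.assoc (evR A), rightTrace_whiskerRight_comp, rightTrace_evR_coevL,
    Category.id_comp]

end PivotalLemmas

end ModifiedSixJ

/-! ### Thickened graphs as morphisms; values of the theta graph and the tetrahedron -/

namespace ModifiedSixJ

namespace BasicData

universe v u w t

variable {K : Type w} [CommRing K] {C : Type u} [Category.{v} C] [MonoidalCategory C]
  [Preadditive C] [Linear K C] [PivotalCategory C] {I : Type t} (B : BasicData K C I)

/-- The isomorphism `V (i*) ≅ (V i)*` given by the basic data. -/
noncomputable def wStar (i : I) : B.V (B.star i) ≅ dual (B.V i) :=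
  B.w (B.star i) ≪≫ eqToIso (by rw [B.star_star])

/-- The pairing `V (i*) ⊗ V i ⟶ 𝟙` represented by a thickened cap. -/
noncomputable def cap (i : I) : B.V (B.star i) ⊗ B.V i ⟶ 𝟙_ C :=
  (B.wStar i).hom ▷ B.V i ≫ evL (B.V i)

theorem cap_eq (i : I) : B.cap i = B.V (B.star i) ◁ (B.w i).hom ≫ evR (B.V (B.star i)) := by
  rw [← B.w_compat i]; simp [cap, wStar]

theorem w_evL (k : I) :
    (B.w k).hom ▷ B.V (B.star k) ≫ evL (B.V (B.star k)) =
      B.V k ◁ (B.wStar k).hom ≫ evR (B.V k) := by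
  -- The compatibility is needed at `star k`, where the label `star (star k)` equals `k` only
  -- propositionally; generalizing that label absorbs the transports.
  have key : ∀ k' (h : B.star (B.star k) = k'),
      ((B.w k').hom ≫ eqToHom (by rw [← h, B.star_star])) ▷ B.V (B.star k) ≫
        evL (B.V (B.star k)) =
      B.V k' ◁ ((B.w (B.star k)).hom ≫ eqToHom (by rw [h])) ≫ evR (B.V k') := by
    rintro _ rfl
    simpa using B.w_compat (B.star k)
  simpa [wStar] using key k (B.star_star k)

variable {B}

variable (B) in
/-- The scalar of an endomorphism of `V i`. -/
noncomputable def coeff (i : I) : (B.V i ⟶ B.V i) →ₗ[K] K := B.bracket (dn i)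

theorem coeff_smul_id (i : I) (f : B.V i ⟶ B.V i) : B.coeff i f • 𝟙 (B.V i) = f :=
  B.bracket_smul_id (dn i) f

/-- Placing a vertex to the left of `R`. -/
def ins {i j k : I} (x : B.H i j k) (R : C) : R ⟶ B.V i ⊗ (B.V j ⊗ (B.V k ⊗ R)) :=
  (λ_ R).inv ≫ x ▷ R ≫ (α_ _ _ _).hom ≫ B.V i ◁ (α_ _ _ _).hom

variable (B) in
/-- Placing a thickened cap to the left of `R`. -/
noncomputable def capAt (i : I) (R : C) : B.V (B.star i) ⊗ (B.V i ⊗ R) ⟶ R :=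
  (α_ _ _ _).inv ≫ B.cap i ▷ R ≫ (λ_ R).hom

theorem ins_naturality {i j k : I} (x : B.H i j k) {R R' : C} (f : R ⟶ R') :
    f ≫ ins x R' = ins x R ≫ B.V i ◁ B.V j ◁ B.V k ◁ f := by
  calc _ = (λ_ R).inv ≫ (𝟙_ C ◁ f ≫ x ▷ R') ≫ (α_ _ _ _).hom ≫ B.V i ◁ (α_ _ _ _).hom := by
        simp [ins]
    _ = _ := by rw [whisker_exchange]; simp [ins]

theorem capAt_naturality (i : I) {R R' : C} (f : R ⟶ R') :
    B.V (B.star i) ◁ B.V i ◁ f ≫ B.capAt i R' = B.capAt i R ≫ f := by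
  calc _ = (α_ _ _ _).inv ≫ ((B.V (B.star i) ⊗ B.V i) ◁ f ≫ B.cap i ▷ R') ≫ (λ_ _).hom := by
        simp [capAt]
    _ = _ := by rw [whisker_exchange]; simp [capAt]

theorem addRight_vertex {i j k : I} (x : B.H i j k) (R : Word I) :
    B.addRight ((vertex x).eval B) R = ins x (B.obj R) := by
  change (λ_ (B.obj R)).inv ≫ (x ≫ B.V i ◁ B.V j ◁ (ρ_ (B.V k)).inv) ▷ B.obj R ≫
    (whiskerLeftIso (B.V i) (whiskerLeftIso (B.V j) (whiskerLeftIso (B.V k) (λ_ (B.obj R)).symm ≪≫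
      (α_ (B.V k) (𝟙_ C) (B.obj R)).symm) ≪≫ (α_ (B.V j) (B.V k ⊗ 𝟙_ C) (B.obj R)).symm) ≪≫
      (α_ (B.V i) (B.V j ⊗ (B.V k ⊗ 𝟙_ C)) (B.obj R)).symm).inv = _
  simp only [ins, Iso.trans_inv, whiskerLeftIso_inv, Iso.symm_inv]
  monoidal

theorem addRight_edge (i : I) (R : Word I) :
    B.addRight ((edge B i).eval B) R = ((B.w i).hom ▷ B.obj R :) := by
  change (whiskerLeftIso (B.V i) (λ_ (B.obj R)).symm ≪≫ (α_ (B.V i) (𝟙_ C) (B.obj R)).symm).hom ≫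
    ((B.w i).hom ▷ 𝟙_ C) ▷ B.obj R ≫ (whiskerLeftIso (dual (B.V (B.star i))) (λ_ (B.obj R)).symm ≪≫
      (α_ (dual (B.V (B.star i))) (𝟙_ C) (B.obj R)).symm).inv = _
  simp only [Iso.trans_inv, whiskerLeftIso_inv, Iso.symm_inv, Iso.trans_hom, whiskerLeftIso_hom,
    Iso.symm_hom]
  monoidal

theorem addRight_capR (i : I) (R : Word I) :
    B.addRight ((Piece.capR (B := B) i).eval B) R =
      ((α_ (B.V i) (dual (B.V i)) (B.obj R)).inv ≫ evR (B.V i) ▷ B.obj R ≫ (λ_ _).hom :) := by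
  change (whiskerLeftIso (B.V i) (whiskerLeftIso (dual (B.V i)) (λ_ (B.obj R)).symm ≪≫
      (α_ (dual (B.V i)) (𝟙_ C) (B.obj R)).symm) ≪≫
      (α_ (B.V i) (dual (B.V i) ⊗ 𝟙_ C) (B.obj R)).symm).hom ≫
    (B.V i ◁ (ρ_ (dual (B.V i))).hom ≫ evR (B.V i)) ▷ B.obj R ≫ (λ_ (B.obj R)).hom = _
  simp only [Iso.trans_hom, whiskerLeftIso_hom, Iso.symm_hom]
  monoidal

theorem addRight_capL (i : I) (R : Word I) :
    B.addRight ((Piece.capL (B := B) i).eval B) R =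
      ((α_ (dual (B.V i)) (B.V i) (B.obj R)).inv ≫ evL (B.V i) ▷ B.obj R ≫ (λ_ _).hom :) := by
  change (whiskerLeftIso (dual (B.V i)) (whiskerLeftIso (B.V i) (λ_ (B.obj R)).symm ≪≫
      (α_ (B.V i) (𝟙_ C) (B.obj R)).symm) ≪≫
      (α_ (dual (B.V i)) (B.V i ⊗ 𝟙_ C) (B.obj R)).symm).hom ≫
    (dual (B.V i) ◁ (ρ_ (B.V i)).hom ≫ evL (B.V i)) ▷ B.obj R ≫ (λ_ (B.obj R)).hom = _
  simp only [Iso.trans_hom, whiskerLeftIso_hom, Iso.symm_hom]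
  monoidal

theorem edge_capR (i : I) (R : C) :
    B.V (B.star i) ◁ (B.w i).hom ▷ R ≫ (α_ (B.V (B.star i)) (dual (B.V (B.star i))) R).inv ≫
      evR (B.V (B.star i)) ▷ R ≫ (λ_ _).hom = B.capAt i R := by
  rw [capAt, cap_eq]; monoidal

variable (B) in
/-- Placing the final thickened cap, with its arrow reversed, to the left of `R`. -/
noncomputable def capRevAt (k : I) (R : C) : B.V k ⊗ (B.V (B.star k) ⊗ R) ⟶ R :=
  (α_ _ _ _).inv ≫ (B.V k ◁ (B.wStar k).hom ≫ evR (B.V k)) ▷ R ≫ (λ_ R).hom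

theorem edge_capL (i : I) (R : C) :
    (B.w i).hom ▷ (B.V (B.star i) ⊗ R) ≫ (α_ (dual (B.V (B.star i))) (B.V (B.star i)) R).inv ≫
      evL (B.V (B.star i)) ▷ R ≫ (λ_ _).hom = B.capRevAt i R := by
  rw [capRevAt, ← w_evL]; monoidal

/-- Closing a morphism `𝟙 ⟶ V i ⊗ V j ⊗ V (k*)` by three thickened caps. -/
noncomputable def closing {i j k : I}
    (g : 𝟙_ C ⟶ B.V i ⊗ (B.V j ⊗ (B.V (B.star k) ⊗ 𝟙_ C))) :
    B.V k ⊗ (B.V (B.star j) ⊗ (B.V (B.star i) ⊗ 𝟙_ C)) ⟶ 𝟙_ C :=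
  B.V k ◁ B.V (B.star j) ◁ (B.V (B.star i) ◁ g ≫ B.capAt i _) ≫
    B.V k ◁ B.capAt j _ ≫ B.capRevAt k (𝟙_ C)

/-- Bending the last leg of a vertex. -/
noncomputable def inAt {i j k : I} (x : B.H i j (B.star k)) (R : C) :
    B.V k ⊗ R ⟶ B.V i ⊗ (B.V j ⊗ R) :=
  ins x (B.V k ⊗ R) ≫ B.V i ◁ B.V j ◁ B.capAt k R

/-- Bending the last two legs of a vertex. -/
noncomputable def outAt {i j k : I} (y : B.H k (B.star j) (B.star i)) (R : C) :
    B.V i ⊗ (B.V j ⊗ R) ⟶ B.V k ⊗ R :=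
  ins y (B.V i ⊗ (B.V j ⊗ R)) ≫ B.V k ◁ B.V (B.star j) ◁ B.capAt i (B.V j ⊗ R) ≫
    B.V k ◁ B.capAt j R

/-- The part of the thickened theta graph above its lower vertex. -/
def thetaTail {i j k : I} (x : B.H i j (B.star k)) :
    B.Diagram [dn k, dn (B.star j), dn (B.star i)] [] :=
  .cons [dn k, dn (B.star j), dn (B.star i)] [] (vertex x) <|
  .cons [dn k, dn (B.star j), dn (B.star i)] [dn j, dn (B.star k)] (edge B i) <|
  .cons [dn k, dn (B.star j)] [dn j, dn (B.star k)] (.capR (B.star i)) <|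
  .cons [dn k, dn (B.star j)] [dn (B.star k)] (edge B j) <|
  .cons [dn k] [dn (B.star k)] (.capR (B.star j)) <|
  .cons [] [dn (B.star k)] (edge B k) <|
  .cons [] [] (.capL (B.star k)) <|
  .nil []

/-- The part of the thickened tetrahedron above its lowest vertex. -/
def tetrahedronTail {i j k l m n : I} (x₁ : B.H i j (B.star k)) (x₂ : B.H k l (B.star m))
    (x₃ : B.H n (B.star l) (B.star j)) :
    B.Diagram [dn m, dn (B.star n), dn (B.star i)] [] :=
  .cons [dn m, dn (B.star n), dn (B.star i)] [] (vertex x₁) <|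
  .cons [dn m, dn (B.star n), dn (B.star i)] [dn j, dn (B.star k)] (edge B i) <|
  .cons [dn m, dn (B.star n)] [dn j, dn (B.star k)] (.capR (B.star i)) <|
  .cons [dn m, dn (B.star n)] [dn j, dn (B.star k)] (vertex x₃) <|
  .cons [dn m, dn (B.star n)] [dn (B.star l), dn (B.star j), dn j, dn (B.star k)] (edge B n) <|
  .cons [dn m] [dn (B.star l), dn (B.star j), dn j, dn (B.star k)] (.capR (B.star n)) <|
  .cons [dn m, dn (B.star l), dn (B.star j)] [dn (B.star k)] (edge B j) <|
  .cons [dn m, dn (B.star l)] [dn (B.star k)] (.capR (B.star j)) <|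
  .cons [dn m, dn (B.star l), dn (B.star k)] [] (vertex x₂) <|
  .cons [dn m, dn (B.star l), dn (B.star k)] [dn l, dn (B.star m)] (edge B k) <|
  .cons [dn m, dn (B.star l)] [dn l, dn (B.star m)] (.capR (B.star k)) <|
  .cons [dn m, dn (B.star l)] [dn (B.star m)] (edge B l) <|
  .cons [dn m] [dn (B.star m)] (.capR (B.star l)) <|
  .cons [] [dn (B.star m)] (edge B m) <|
  .cons [] [] (.capL (B.star m)) <|
  .nil []

theorem eval_thetaTail {i j k : I} (x : B.H i j (B.star k)) :
    (thetaTail x).eval = closing (ins x (𝟙_ C)) := by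
  have h : (thetaTail x).eval =
      (B.V k ◁ B.V (B.star j) ◁ B.V (B.star i) ◁ (B.addRight ((vertex x).eval B) [] :) ≫
      B.V k ◁ B.V (B.star j) ◁ B.V (B.star i) ◁
        (B.addRight ((edge B i).eval B) [dn j, dn (B.star k)] :) ≫
      B.V k ◁ B.V (B.star j) ◁ (B.addRight ((Piece.capR (B.star i)).eval B)
        [dn j, dn (B.star k)] :) ≫
      B.V k ◁ B.V (B.star j) ◁ (B.addRight ((edge B j).eval B) [dn (B.star k)] :) ≫
      B.V k ◁ (B.addRight ((Piece.capR (B.star j)).eval B) [dn (B.star k)] :) ≫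
      (B.addRight ((edge B k).eval B) [dn (B.star k)] :) ≫
      (B.addRight ((Piece.capL (B.star k)).eval B) [] :) ≫ 𝟙 (𝟙_ C) :) := rfl
  rw [h, addRight_vertex, addRight_edge, addRight_edge, addRight_edge, addRight_capR,
    addRight_capR, addRight_capL]
  dsimp only [obj, strand, List.cons_append, List.nil_append, closing]
  simp only [← edge_capR, ← edge_capL, MonoidalCategory.whiskerLeft_comp,
    Category.assoc, Category.comp_id]

/-- Naturality slides the three upper vertices together into one morphism 𝟙 ⟶ V_i ⊗ V_n ⊗ V_{m*}, so
the tetrahedron is a theta graph with a composite upper vertex. -/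
theorem eval_tetrahedronTail {i j k l m n : I} (x₁ : B.H i j (B.star k))
    (x₂ : B.H k l (B.star m)) (x₃ : B.H n (B.star l) (B.star j)) :
    (tetrahedronTail x₁ x₂ x₃).eval = closing (ins x₂ (𝟙_ C) ≫ inAt x₁ _ ≫ B.V i ◁ outAt x₃ _) := by
  have h : (tetrahedronTail x₁ x₂ x₃).eval =
      (B.V m ◁ B.V (B.star n) ◁ B.V (B.star i) ◁ (B.addRight ((vertex x₁).eval B) [] :) ≫
      B.V m ◁ B.V (B.star n) ◁ B.V (B.star i) ◁
        (B.addRight ((edge B i).eval B) [dn j, dn (B.star k)] :) ≫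
      B.V m ◁ B.V (B.star n) ◁ (B.addRight ((Piece.capR (B.star i)).eval B)
        [dn j, dn (B.star k)] :) ≫
      B.V m ◁ B.V (B.star n) ◁ (B.addRight ((vertex x₃).eval B) [dn j, dn (B.star k)] :) ≫
      B.V m ◁ B.V (B.star n) ◁ (B.addRight ((edge B n).eval B)
        [dn (B.star l), dn (B.star j), dn j, dn (B.star k)] :) ≫
      B.V m ◁ (B.addRight ((Piece.capR (B.star n)).eval B)
        [dn (B.star l), dn (B.star j), dn j, dn (B.star k)] :) ≫
      B.V m ◁ B.V (B.star l) ◁ B.V (B.star j) ◁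
        (B.addRight ((edge B j).eval B) [dn (B.star k)] :) ≫
      B.V m ◁ B.V (B.star l) ◁ (B.addRight ((Piece.capR (B.star j)).eval B) [dn (B.star k)] :) ≫
      B.V m ◁ B.V (B.star l) ◁ B.V (B.star k) ◁ (B.addRight ((vertex x₂).eval B) [] :) ≫
      B.V m ◁ B.V (B.star l) ◁ B.V (B.star k) ◁
        (B.addRight ((edge B k).eval B) [dn l, dn (B.star m)] :) ≫
      B.V m ◁ B.V (B.star l) ◁ (B.addRight ((Piece.capR (B.star k)).eval B)
        [dn l, dn (B.star m)] :) ≫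
      B.V m ◁ B.V (B.star l) ◁ (B.addRight ((edge B l).eval B) [dn (B.star m)] :) ≫
      B.V m ◁ (B.addRight ((Piece.capR (B.star l)).eval B) [dn (B.star m)] :) ≫
      (B.addRight ((edge B m).eval B) [dn (B.star m)] :) ≫
      (B.addRight ((Piece.capL (B.star m)).eval B) [] :) ≫ 𝟙 (𝟙_ C) :) := rfl
  rw [h]
  simp only [addRight_vertex, addRight_edge, addRight_capR, addRight_capL]
  dsimp only [obj, strand, List.cons_append, List.nil_append, closing]
  have hR (i : I) (R : C) {Z : C} (f : B.V m ⊗ R ⟶ Z) :=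
    congrArg (fun t => B.V m ◁ t ≫ f) (edge_capR (B := B) i R)
  have hR' (a i : I) (R : C) {Z : C} (f : B.V m ⊗ (B.V a ⊗ R) ⟶ Z) :=
    congrArg (fun t => B.V m ◁ B.V a ◁ t ≫ f) (edge_capR (B := B) i R)
  simp only [MonoidalCategory.whiskerLeft_comp, Category.assoc] at hR hR'
  simp only [MonoidalCategory.whiskerLeft_comp, Category.assoc, Category.comp_id, hR, hR',
    edge_capL]
  simp only [← MonoidalCategory.whiskerLeft_comp_assoc]
  congr 2
  have e₁ : ins x₂ (𝟙_ C) ≫ inAt x₁ _ ≫ B.V i ◁ outAt x₃ _ = ins x₁ (𝟙_ C) ≫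
      B.V i ◁ (B.V j ◁ (B.V (B.star k) ◁ ins x₂ (𝟙_ C) ≫ B.capAt k _) ≫ outAt x₃ _) := by
    simp only [inAt, Category.assoc, MonoidalCategory.whiskerLeft_comp]
    rw [← Category.assoc, ins_naturality]
    simp only [Category.assoc]
  have e₂ (q : B.V (B.star k) ⊗ 𝟙_ C ⟶ B.V l ⊗ (B.V (B.star m) ⊗ 𝟙_ C)) :
      B.V j ◁ q ≫ outAt x₃ _ = ins x₃ _ ≫ B.V n ◁ (B.V (B.star l) ◁ (B.capAt j _ ≫ q) ≫
        B.capAt l _) := by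
    rw [outAt, ← Category.assoc, ins_naturality, ← capAt_naturality]
    simp only [MonoidalCategory.whiskerLeft_comp, Category.assoc]
  rw [e₁, e₂, MonoidalCategory.whiskerLeft_comp (B.V (B.star i)), Category.assoc,
    capAt_naturality]
  generalize hG : B.V (B.star l) ◁ (B.capAt j _ ≫ B.V (B.star k) ◁ ins x₂ (𝟙_ C) ≫
    B.capAt k _) ≫ B.capAt l _ = G
  simp only [MonoidalCategory.whiskerLeft_comp, Category.assoc, capAt_naturality]

/-- The morphism `V k ⟶ V i ⊗ V j` obtained from a vertex by bending its last leg down. -/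
noncomputable def bendIn {i j k : I} (x : B.H i j (B.star k)) : B.V k ⟶ B.V i ⊗ B.V j :=
  (λ_ (B.V k)).inv ≫ x ▷ B.V k ⊗≫ (B.V i ⊗ B.V j) ◁ B.cap k ≫ (ρ_ (B.V i ⊗ B.V j)).hom

variable (B) in
/-- Two nested thickened caps. -/
noncomputable def nestedCaps (i j : I) :
    (B.V (B.star j) ⊗ B.V (B.star i)) ⊗ (B.V i ⊗ B.V j) ⟶ 𝟙_ C :=
  𝟙 _ ⊗≫ B.V (B.star j) ◁ B.cap i ▷ B.V j ⊗≫ B.cap j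

/-- The morphism `V i ⊗ V j ⟶ V k` obtained from a vertex by bending its last two legs down. -/
noncomputable def bendOut {i j k : I} (y : B.H k (B.star j) (B.star i)) :
    B.V i ⊗ B.V j ⟶ B.V k :=
  (λ_ (B.V i ⊗ B.V j)).inv ≫ y ▷ (B.V i ⊗ B.V j) ⊗≫ B.V k ◁ B.nestedCaps i j ≫ (ρ_ (B.V k)).hom

theorem inAt_eq {i j k : I} (x : B.H i j (B.star k)) (R : C) :
    inAt x R = bendIn x ▷ R ≫ (α_ _ _ _).hom := by
  simp only [inAt, bendIn, ins, capAt]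
  monoidal

theorem outAt_eq {i j k : I} (y : B.H k (B.star j) (B.star i)) (R : C) :
    outAt y R = (α_ _ _ _).inv ≫ bendOut y ▷ R := by
  simp only [outAt, bendOut, ins, capAt, nestedCaps]
  monoidal

/-- Composition of a vertex with a morphism of its first two legs. -/
def legs {i j i' j' k : I} (x : B.H i j k) (h : B.V i ⊗ B.V j ⟶ B.V i' ⊗ B.V j') : B.H i' j' k :=
  x ≫ (α_ _ _ _).inv ≫ h ▷ B.V k ≫ (α_ _ _ _).hom

/-- The composite upper vertex of the tetrahedron is itself a vector of a multiplicity module, so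
`rightTrace_closing` applies to it. -/
theorem ins_legs {i j k l m n : I} (x₁ : B.H i j (B.star k)) (x₂ : B.H k l (B.star m))
    (x₃ : B.H n (B.star l) (B.star j)) :
    ins (legs x₂ (bendIn x₁ ▷ B.V l ≫ (α_ _ _ _).hom ≫ B.V i ◁ bendOut x₃)) (𝟙_ C) =
      ins x₂ (𝟙_ C) ≫ inAt x₁ _ ≫ B.V i ◁ outAt x₃ _ := by
  rw [inAt_eq, outAt_eq]
  simp only [ins, legs]
  monoidal

theorem bendIn_legs {i j i' j' k : I} (x : B.H i j (B.star k))
    (h : B.V i ⊗ B.V j ⟶ B.V i' ⊗ B.V j') : bendIn (legs x h) = bendIn x ≫ h := by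
  simp only [bendIn, legs]
  calc _ = 𝟙 _ ⊗≫ x ▷ B.V k ⊗≫ (h ▷ (B.V (B.star k) ⊗ B.V k) ≫
        (B.V i' ⊗ B.V j') ◁ B.cap k) ⊗≫ 𝟙 _ := by monoidal
    _ = _ := by rw [← whisker_exchange]; monoidal

/-- An instance of `rightTrace_theta` in which the edges i and j run together as one strand V_i ⊗
V_j; `a` turns the nested caps into the cap of this strand. -/
theorem rightTrace_closing {i j k : I} (x : B.H i j (B.star k))
    (y : B.H k (B.star j) (B.star i)) :
    rightTrace (B.V (B.star j) ⊗ (B.V (B.star i) ⊗ 𝟙_ C))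
      (closing (ins x (𝟙_ C)) ≫ ins y (𝟙_ C)) = bendIn x ≫ bendOut y := by
  obtain ⟨a, ha⟩ := exists_evL (V := B.V i ⊗ B.V j)
    (X := B.V (B.star j) ⊗ (B.V (B.star i) ⊗ 𝟙_ C)) (𝟙 _ ⊗≫ B.nestedCaps i j)
  have h := rightTrace_theta (B.wStar k).hom a (x ≫ (α_ _ _ _).inv) (ins y (𝟙_ C))
  rw [ha] at h
  convert h using 3
  · simp only [closing, ins, capAt, capRevAt, nestedCaps]
    monoidal
  · simp only [bendIn, cap]
    monoidal
  · simp only [bendOut, ins]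
    monoidal

theorem exists_cutsAux {X Z : Word I} (D : B.Diagram X Z) (below : 𝟙_ C ⟶ B.obj X)
    (above : B.obj Z ⟶ 𝟙_ C) :
    ∃ l, D.cutsAux below above = B.levelCuts X below (D.eval ≫ above) ++ l := by
  cases D with
  | nil W => exact ⟨[], by simp [Diagram.cutsAux, Diagram.eval]⟩
  | cons L R g D => exact ⟨_, rfl⟩

/-- To the left of the first strand there is only the unit, whose closure `leftTrace_unit` removes.
-/
theorem cutEnd_zero {i j k : I} (p : 𝟙_ C ⟶ B.V i ⊗ (B.V j ⊗ (B.V k ⊗ 𝟙_ C)))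
    (q : B.V i ⊗ (B.V j ⊗ (B.V k ⊗ 𝟙_ C)) ⟶ 𝟙_ C) :
    B.cutEnd [dn i, dn j, dn k] ⟨0, Nat.succ_pos _⟩ p q =
      rightTrace (B.V j ⊗ (B.V k ⊗ 𝟙_ C)) (q ≫ p) :=
  congrArg (rightTrace (B.V j ⊗ (B.V k ⊗ 𝟙_ C))) (leftTrace_unit (q ≫ p))

/-- The invariant of a closed graph whose lowest vertex has its first leg labelled in `I₀`. -/
theorem gPrime_cons_vertex {I₀ : Set I} (d : I → K) {i j k : I} (hi : i ∈ I₀) (x : B.H i j k)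
    (D : B.Diagram [dn i, dn j, dn k] []) (e : B.V i ⊗ (B.V j ⊗ (B.V k ⊗ 𝟙_ C)) ⟶ 𝟙_ C)
    (he : D.eval = e) (f : B.V i ⟶ B.V i)
    (hf : rightTrace (B.V j ⊗ (B.V k ⊗ 𝟙_ C)) (e ≫ ins x (𝟙_ C)) = f) :
    (Diagram.cons [] [] (vertex x) D : B.Diagram [] []).gPrime I₀ d =
      d i * B.coeff i f := by
  have hb : 𝟙 (𝟙_ C) ≫ B.addRight ((vertex x).eval B) [] = ins x (𝟙_ C) :=
    (Category.id_comp _).trans (addRight_vertex x [])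
  -- The lowest level is the empty word and contributes no cut; the list starts at the level just
  -- above the vertex.
  have h₁ : (Diagram.cons [] [] (vertex x) D : B.Diagram [] []).cuts =
      D.cutsAux (ins x (𝟙_ C)) (𝟙 (𝟙_ C)) := congrArg (fun p => D.cutsAux p _) hb
  have h₂ : D.eval ≫ 𝟙 (𝟙_ C) = e := (Category.comp_id _).trans he
  have h₃ {n : ℕ} (F : Fin (n + 1) → I × K) : ∃ l, List.ofFn F = F 0 :: l :=
    ⟨_, List.ofFn_succ⟩
  obtain ⟨l, hl⟩ := exists_cutsAux D (ins x (𝟙_ C)) (𝟙 (𝟙_ C))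
  obtain ⟨l', hl'⟩ : ∃ l', B.levelCuts [dn i, dn j, dn k] (ins x (𝟙_ C)) e =
      (i, B.coeff i f) :: l' := by
    obtain ⟨l', hl'⟩ := h₃ (fun n : Fin (2 + 1) => (([dn i, dn j, dn k].get n).1,
      B.bracket _ (B.cutEnd [dn i, dn j, dn k] n (ins x (𝟙_ C)) e)))
    exact ⟨l', hl'.trans (congrArg (fun g => (i, B.coeff i g) :: l')
      ((cutEnd_zero (ins x (𝟙_ C)) e).trans hf))⟩
  have h₄ : (Diagram.cons [] [] (vertex x) D : B.Diagram [] []).cuts =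
      ((i, B.coeff i f) :: l') ++ l := by
    refine h₁.trans (hl.trans (congrArg (· ++ l) (Eq.trans ?_ hl')))
    exact congrArg (B.levelCuts [dn i, dn j, dn k] (ins x (𝟙_ C))) h₂
  unfold Diagram.gPrime
  rw [h₄, List.cons_append, List.find?_cons_of_pos (by simpa using hi)]

theorem gPrime_thetaGraph {I₀ : Set I} (d : I → K) {i j k : I} (hk : k ∈ I₀)
    (x : B.H i j (B.star k)) (y : B.H k (B.star j) (B.star i)) :
    (thetaGraph x y).gPrime I₀ d = d k * B.coeff k (bendIn x ≫ bendOut y) :=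
  gPrime_cons_vertex d hk y (thetaTail x) _ (eval_thetaTail x) _ (rightTrace_closing x y)

theorem gPrime_tetrahedron {I₀ : Set I} (d : I → K) {i j k l m n : I} (hm : m ∈ I₀)
    (x₁ : B.H i j (B.star k)) (x₂ : B.H k l (B.star m)) (x₃ : B.H n (B.star l) (B.star j))
    (x₄ : B.H m (B.star n) (B.star i)) :
    (tetrahedron x₁ x₂ x₃ x₄).gPrime I₀ d = d m * B.coeff m
      (bendIn x₂ ≫ bendIn x₁ ▷ B.V l ≫ (α_ _ _ _).hom ≫ B.V i ◁ bendOut x₃ ≫ bendOut x₄) := by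
  refine gPrime_cons_vertex d hm x₄ (tetrahedronTail x₁ x₂ x₃) _ (eval_tetrahedronTail x₁ x₂ x₃) _ ?_
  rw [← ins_legs, rightTrace_closing, bendIn_legs]
  simp only [Category.assoc]

/-- Bending is the adjunction of a duality, with the dual of V_k replaced by V_{k*} along `wStar`.
-/
theorem bendIn_bijective (i j k : I) :
    Function.Bijective (bendIn : B.H i j (B.star k) → (B.V k ⟶ B.V i ⊗ B.V j)) := by
  let _ : ExactPairing (B.V k) (dual (B.V k)) := TwoSidedDuality.left _
  let _ : ExactPairing (B.V k) (B.V (B.star k)) := exactPairingCongrRight (B.wStar k)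
  have h : (bendIn : B.H i j (B.star k) → (B.V k ⟶ B.V i ⊗ B.V j)) =
      ((α_ (B.V i) (B.V j) (B.V (B.star k))).symm.homToEquiv.trans
        ((tensorRightHomEquiv (𝟙_ C) (B.V k) (B.V (B.star k)) (B.V i ⊗ B.V j)).symm.trans
          (λ_ (B.V k)).homFromEquiv)) := by
    funext x
    change _ = (λ_ (B.V k)).inv ≫ (x ≫ (α_ _ _ _).inv) ▷ B.V k ≫ (α_ _ _ _).hom ≫
      (B.V i ⊗ B.V j) ◁ B.cap k ≫ (ρ_ _).hom
    rw [bendIn]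
    monoidal
  rw [h]
  exact Equiv.bijective _

theorem bendOut_bijective (i j k : I) :
    Function.Bijective
      (bendOut : B.H k (B.star j) (B.star i) → (B.V i ⊗ B.V j ⟶ B.V k)) := by
  let _ (l : I) : ExactPairing (B.V l) (dual (B.V l)) := TwoSidedDuality.left _
  let _ (l : I) : ExactPairing (B.V l) (B.V (B.star l)) := exactPairingCongrRight (B.wStar l)
  have h : (bendOut : B.H k (B.star j) (B.star i) → (B.V i ⊗ B.V j ⟶ B.V k)) =
      ((tensorRightHomEquiv (𝟙_ C) (B.V i ⊗ B.V j) (B.V (B.star j) ⊗ B.V (B.star i))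
        (B.V k)).symm.trans (λ_ (B.V i ⊗ B.V j)).homFromEquiv) := by
    funext y
    -- The exact pairing of V_i ⊗ V_j with V_{j*} ⊗ V_{i*} has the nested caps as its evaluation.
    change _ = (λ_ (B.V i ⊗ B.V j)).inv ≫ y ▷ (B.V i ⊗ B.V j) ≫ (α_ _ _ _).hom ≫
      B.V k ◁ (𝟙 _ ⊗≫ B.V (B.star j) ◁ (B.cap i ▷ B.V j) ⊗≫ B.cap j) ≫ (ρ_ _).hom
    rw [bendOut, nestedCaps]
    monoidal
  rw [h]
  exact Equiv.bijective _

section Linear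

variable [MonoidalPreadditive C] [MonoidalLinear K C]

variable (B) in
/-- Bending the last leg of a vertex as a linear isomorphism. -/
noncomputable def bendInEquiv (i j k : I) : B.H i j (B.star k) ≃ₗ[K] (B.V k ⟶ B.V i ⊗ B.V j) :=
  LinearEquiv.ofBijective
    { toFun := bendIn
      map_add' := fun x y => by simp [bendIn, monoidalComp]
      map_smul' := fun a x => by simp [bendIn, monoidalComp] }
    (bendIn_bijective i j k)

variable (B) in
/-- Bending the last two legs of a vertex as a linear isomorphism. -/
noncomputable def bendOutEquiv (i j k : I) :
    B.H k (B.star j) (B.star i) ≃ₗ[K] (B.V i ⊗ B.V j ⟶ B.V k) :=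
  LinearEquiv.ofBijective
    { toFun := bendOut
      map_add' := fun x y => by simp [bendOut, monoidalComp]
      map_smul' := fun a x => by simp [bendOut, monoidalComp] }
    (bendOut_bijective i j k)

theorem bendInEquiv_apply {i j k : I} (x : B.H i j (B.star k)) :
    B.bendInEquiv i j k x = bendIn x := rfl

theorem bendOutEquiv_apply {i j k : I} (y : B.H k (B.star j) (B.star i)) :
    B.bendOutEquiv i j k y = bendOut y := rfl

end Linear

end BasicData
end ModifiedSixJ

/-! ### Perfect pairings through dual families, and contractions evaluated on vectors -/

namespace ModifiedSixJ

section DualFamilies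

open TensorProduct

universe v w

variable {K : Type w} [CommRing K]

section

variable {M N M' N' : Type*} [AddCommGroup M] [AddCommGroup N] [AddCommGroup M'] [AddCommGroup N']
  [Module K M] [Module K N] [Module K M'] [Module K N']

/-- Two finite families that are dual to each other with respect to a pairing. -/
structure IsDualFamily (P : M →ₗ[K] N →ₗ[K] K) {r : Type*} [Fintype r] (m : r → M) (n : r → N) :
    Prop where
  sum_left : ∀ x, ∑ a, P x (n a) • m a = x
  sum_right : ∀ y, ∑ a, P (m a) y • n a = y

/-- A pairing admitting finite dual families. -/
def HasDualFamily (P : M →ₗ[K] N →ₗ[K] K) : Prop :=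
  ∃ (r : Type) (_ : Fintype r) (m : r → M) (n : r → N), IsDualFamily P m n

/-- The tensor product of two pairings. -/
noncomputable def tensorPairing (P : M →ₗ[K] N →ₗ[K] K) (P' : M' →ₗ[K] N' →ₗ[K] K) :
    M ⊗[K] M' →ₗ[K] N ⊗[K] N' →ₗ[K] K :=
  TensorProduct.dualDistrib K N N' ∘ₗ TensorProduct.map P P'

theorem tensorPairing_tmul (P : M →ₗ[K] N →ₗ[K] K) (P' : M' →ₗ[K] N' →ₗ[K] K) (x : M) (x' : M')
    (y : N) (y' : N') :
    tensorPairing P P' (x ⊗ₜ[K] x') (y ⊗ₜ[K] y') = P x y * P' x' y' := rfl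

theorem IsDualFamily.apply_eq_sum {P : M →ₗ[K] N →ₗ[K] K} {r : Type*} [Fintype r] {m : r → M}
    {n : r → N} (h : IsDualFamily P m n) (x : M) (y : N) :
    P x y = ∑ a, P x (n a) * P (m a) y := by
  conv_lhs => rw [← h.sum_left x]
  simp

theorem HasDualFamily.flip {P : M →ₗ[K] N →ₗ[K] K} (h : HasDualFamily P) :
    HasDualFamily P.flip := by
  obtain ⟨r, _, m, n, h⟩ := h
  exact ⟨r, ‹_›, n, m, h.sum_right, h.sum_left⟩

theorem HasDualFamily.tensor {P : M →ₗ[K] N →ₗ[K] K} {P' : M' →ₗ[K] N' →ₗ[K] K}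
    (h : HasDualFamily P) (h' : HasDualFamily P') : HasDualFamily (tensorPairing P P') := by
  obtain ⟨r, _, m, n, h⟩ := h
  obtain ⟨r', _, m', n', h'⟩ := h'
  refine ⟨r × r', inferInstance, fun a => m a.1 ⊗ₜ[K] m' a.2, fun a => n a.1 ⊗ₜ[K] n' a.2, ?_, ?_⟩
  · intro x
    induction x with
    | zero => simp
    | add x y hx hy => simp only [map_add, LinearMap.add_apply, add_smul, Finset.sum_add_distrib, hx, hy]
    | tmul x x' =>
      conv_rhs => rw [← h.sum_left x, ← h'.sum_left x']
      simp only [TensorProduct.sum_tmul, TensorProduct.tmul_sum, Fintype.sum_prod_type,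
        tensorPairing_tmul, TensorProduct.smul_tmul_smul]
      rw [Finset.sum_comm]
  · intro x
    induction x with
    | zero => simp
    | add x y hx hy => simp only [map_add, add_smul, Finset.sum_add_distrib, hx, hy]
    | tmul x x' =>
      conv_rhs => rw [← h.sum_right x, ← h'.sum_right x']
      simp only [TensorProduct.sum_tmul, TensorProduct.tmul_sum, Fintype.sum_prod_type,
        tensorPairing_tmul, TensorProduct.smul_tmul_smul]
      rw [Finset.sum_comm]

/-- The inverse sends a form f to ∑ₐ f(nₐ) mₐ; no freeness of the modules is involved. -/
theorem HasDualFamily.bijective {P : M →ₗ[K] N →ₗ[K] K} (h : HasDualFamily P) :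
    Function.Bijective (P : M → Module.Dual K N) := by
  obtain ⟨r, _, m, n, h⟩ := h
  constructor
  · intro x y hxy
    rw [← h.sum_left x, ← h.sum_left y, hxy]
  · intro f
    refine ⟨∑ a, f (n a) • m a, LinearMap.ext fun y => ?_⟩
    conv_rhs => rw [← h.sum_right y]
    simp [mul_comm]

end

theorem tensor_induction₄ {A₁ A₂ A₃ A₄ : Type*} [AddCommGroup A₁] [AddCommGroup A₂]
    [AddCommGroup A₃] [AddCommGroup A₄] [Module K A₁] [Module K A₂] [Module K A₃] [Module K A₄]
    {p : A₁ ⊗[K] (A₂ ⊗[K] (A₃ ⊗[K] A₄)) → Prop} (add : ∀ s t, p s → p t → p (s + t))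
    (tmul : ∀ a b c e, p (a ⊗ₜ[K] (b ⊗ₜ[K] (c ⊗ₜ[K] e)))) (t : A₁ ⊗[K] (A₂ ⊗[K] (A₃ ⊗[K] A₄))) : p t := by
  induction t with
  | zero => simpa using tmul 0 0 0 0
  | add s t hs ht => exact add s t hs ht
  | tmul a t =>
    induction t with
    | zero => simpa using tmul 0 0 0 0
    | add s t hs ht => rw [TensorProduct.tmul_add]; exact add _ _ hs ht
    | tmul b t =>
      induction t with
      | zero => simpa using tmul 0 0 0 0
      | add s t hs ht => rw [TensorProduct.tmul_add, TensorProduct.tmul_add]; exact add _ _ hs ht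
      | tmul c e => exact tmul a b c e

section

variable {A₁ A₂ A₃ A₄ B₁ B₂ B₃ B₄ C₁ C₂ C₃ C₄ X₁ X₂ X₃ X₄ X₅ X₆ : Type v}
  [AddCommGroup A₁] [AddCommGroup A₂] [AddCommGroup A₃] [AddCommGroup A₄]
  [AddCommGroup B₁] [AddCommGroup B₂] [AddCommGroup B₃] [AddCommGroup B₄]
  [AddCommGroup C₁] [AddCommGroup C₂] [AddCommGroup C₃] [AddCommGroup C₄]
  [AddCommGroup X₁] [AddCommGroup X₂] [AddCommGroup X₃] [AddCommGroup X₄]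
  [AddCommGroup X₅] [AddCommGroup X₆]
  [Module K A₁] [Module K A₂] [Module K A₃] [Module K A₄]
  [Module K B₁] [Module K B₂] [Module K B₃] [Module K B₄]
  [Module K C₁] [Module K C₂] [Module K C₃] [Module K C₄]
  [Module K X₁] [Module K X₂] [Module K X₃] [Module K X₄] [Module K X₅] [Module K X₆]

theorem tensor_ext₆ {f g : ((X₂ ⊗[K] X₁) ⊗[K] (X₃ ⊗[K] X₄)) ⊗[K] (X₅ ⊗[K] X₆) →ₗ[K] K}
    (h : ∀ x₁ x₂ x₃ x₄ x₅ x₆, f (((x₂ ⊗ₜ[K] x₁) ⊗ₜ[K] (x₃ ⊗ₜ[K] x₄)) ⊗ₜ[K] (x₅ ⊗ₜ[K] x₆)) =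
      g (((x₂ ⊗ₜ[K] x₁) ⊗ₜ[K] (x₃ ⊗ₜ[K] x₄)) ⊗ₜ[K] (x₅ ⊗ₜ[K] x₆))) : f = g := by
  ext x₂ x₁ x₃ x₄ x₅ x₆
  exact h x₁ x₂ x₃ x₄ x₅ x₆

/-- Evaluation of a triple contraction by means of dual families. -/
theorem tensorPairing_contract₃ (f₁ : A₁ →ₗ[K] X₁ →ₗ[K] K) (f₂ : A₂ →ₗ[K] X₂ →ₗ[K] K)
    (f₃ : B₂ →ₗ[K] X₃ →ₗ[K] K) (f₄ : B₄ →ₗ[K] X₄ →ₗ[K] K) (f₅ : C₄ →ₗ[K] X₅ →ₗ[K] K)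
    (f₆ : C₃ →ₗ[K] X₆ →ₗ[K] K)
    {p : A₃ →ₗ[K] C₁ →ₗ[K] K} {q : B₃ →ₗ[K] C₂ →ₗ[K] K} {r : A₄ →ₗ[K] B₁ →ₗ[K] K}
    {U V W : Type*} [Fintype U] [Fintype V] [Fintype W]
    {mu : U → A₃} {nu : U → C₁} {mv : V → B₃} {nv : V → C₂} {mw : W → A₄} {nw : W → B₁}
    (hp : IsDualFamily p mu nu) (hq : IsDualFamily q mv nv) (hr : IsDualFamily r mw nw)
    (x₁ : X₁) (x₂ : X₂) (x₃ : X₃) (x₄ : X₄) (x₅ : X₅) (x₆ : X₆)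
    (s : A₁ ⊗[K] (A₂ ⊗[K] (A₃ ⊗[K] A₄))) (t : B₁ ⊗[K] (B₂ ⊗[K] (B₃ ⊗[K] B₄)))
    (z : C₁ ⊗[K] (C₂ ⊗[K] (C₃ ⊗[K] C₄))) :
    tensorPairing (tensorPairing (tensorPairing f₂ f₁) (tensorPairing f₃ f₄))
        (tensorPairing f₅ f₆) (contract₃ p q r ((s ⊗ₜ[K] t) ⊗ₜ[K] z))
        (((x₂ ⊗ₜ[K] x₁) ⊗ₜ[K] (x₃ ⊗ₜ[K] x₄)) ⊗ₜ[K] (x₅ ⊗ₜ[K] x₆)) =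
      ∑ a, ∑ b, ∑ c,
        tensorPairing f₁ (tensorPairing f₂ (tensorPairing p r)) s
          (x₁ ⊗ₜ[K] (x₂ ⊗ₜ[K] (nu a ⊗ₜ[K] nw c))) *
        tensorPairing r.flip (tensorPairing f₃ (tensorPairing q f₄)) t
          (mw c ⊗ₜ[K] (x₃ ⊗ₜ[K] (nv b ⊗ₜ[K] x₄))) *
        tensorPairing p.flip (tensorPairing q.flip (tensorPairing f₆ f₅)) z
          (mu a ⊗ₜ[K] (mv b ⊗ₜ[K] (x₆ ⊗ₜ[K] x₅))) := by
  induction s using tensor_induction₄ with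
  | add s s' hs hs' =>
    simp only [TensorProduct.add_tmul, map_add, LinearMap.add_apply, hs, hs', add_mul,
      Finset.sum_add_distrib]
  | tmul a₁ a₂ a₃ a₄ =>
  induction t using tensor_induction₄ with
  | add s s' hs hs' =>
    simp only [TensorProduct.tmul_add, TensorProduct.add_tmul, map_add, LinearMap.add_apply, hs,
      hs', mul_add, add_mul, Finset.sum_add_distrib]
  | tmul b₁ b₂ b₃ b₄ =>
  induction z using tensor_induction₄ with
  | add s s' hs hs' =>
    simp only [TensorProduct.tmul_add, map_add, LinearMap.add_apply, hs, hs', mul_add,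
      Finset.sum_add_distrib]
  | tmul c₁ c₂ c₃ c₄ =>
  rw [contract₃_tmul]
  simp only [map_smul, LinearMap.smul_apply, tensorPairing_tmul, smul_eq_mul, LinearMap.flip_apply]
  -- Each contracted scalar splits through its dual family into two factors, which are then
  -- distributed over the tensors being contracted.
  rw [hp.apply_eq_sum, hq.apply_eq_sum, hr.apply_eq_sum, Finset.sum_mul_sum, Finset.sum_mul,
    Finset.sum_mul]
  refine Finset.sum_congr rfl fun a _ => ?_
  rw [Finset.sum_mul, Finset.sum_mul]
  refine Finset.sum_congr rfl fun b _ => ?_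
  rw [Finset.mul_sum, Finset.sum_mul]
  refine Finset.sum_congr rfl fun c _ => ?_
  ring

/-- Evaluation of a simple contraction by means of dual families. -/
theorem tensorPairing_contract₁ (f₁ : A₁ →ₗ[K] X₂ →ₗ[K] K) (f₂ : A₂ →ₗ[K] X₃ →ₗ[K] K)
    (f₃ : A₃ →ₗ[K] X₆ →ₗ[K] K) (f₄ : B₁ →ₗ[K] X₁ →ₗ[K] K) (f₅ : B₃ →ₗ[K] X₅ →ₗ[K] K)
    (f₆ : B₄ →ₗ[K] X₄ →ₗ[K] K) {r : A₄ →ₗ[K] B₂ →ₗ[K] K}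
    {W : Type*} [Fintype W] {mw : W → A₄} {nw : W → B₂} (hr : IsDualFamily r mw nw)
    (x₁ : X₁) (x₂ : X₂) (x₃ : X₃) (x₄ : X₄) (x₅ : X₅) (x₆ : X₆)
    (s : A₁ ⊗[K] (A₂ ⊗[K] (A₃ ⊗[K] A₄))) (t : B₁ ⊗[K] (B₂ ⊗[K] (B₃ ⊗[K] B₄))) :
    tensorPairing (tensorPairing (tensorPairing f₁ f₄) (tensorPairing f₂ f₆))
        (tensorPairing f₅ f₃) (contract₁ r (s ⊗ₜ[K] t))
        (((x₂ ⊗ₜ[K] x₁) ⊗ₜ[K] (x₃ ⊗ₜ[K] x₄)) ⊗ₜ[K] (x₅ ⊗ₜ[K] x₆)) =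
      ∑ c,
        tensorPairing f₁ (tensorPairing f₂ (tensorPairing f₃ r)) s
          (x₂ ⊗ₜ[K] (x₃ ⊗ₜ[K] (x₆ ⊗ₜ[K] nw c))) *
        tensorPairing f₄ (tensorPairing r.flip (tensorPairing f₅ f₆)) t
          (x₁ ⊗ₜ[K] (mw c ⊗ₜ[K] (x₅ ⊗ₜ[K] x₄))) := by
  induction s using tensor_induction₄ with
  | add s s' hs hs' =>
    simp only [TensorProduct.add_tmul, map_add, LinearMap.add_apply, hs, hs', add_mul,
      Finset.sum_add_distrib]
  | tmul a₁ a₂ a₃ a₄ =>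
  induction t using tensor_induction₄ with
  | add s s' hs hs' =>
    simp only [TensorProduct.tmul_add, map_add, LinearMap.add_apply, hs, hs', mul_add,
      Finset.sum_add_distrib]
  | tmul b₁ b₂ b₃ b₄ =>
  rw [contract₁_tmul]
  simp only [map_smul, LinearMap.smul_apply, tensorPairing_tmul, smul_eq_mul, LinearMap.flip_apply]
  rw [hr.apply_eq_sum]
  simp only [Finset.sum_mul]
  refine Finset.sum_congr rfl fun c _ => ?_
  ring

end

end DualFamilies

end ModifiedSixJ

/-! ### Good pairs have perfect pairings -/

namespace ModifiedSixJ

namespace BasicData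

universe v u w t

variable {K : Type w} [CommRing K] {C : Type u} [Category.{v} C] [MonoidalCategory C]
  [Preadditive C] [Linear K C] [PivotalCategory C] {I : Type t} {B : BasicData K C I}

/-- Only the resolution of the identity is kept: the arguments below replace orthogonality of the
projections by Schur's lemma. -/
theorem IsGood.exists_decomposition {I₀ : Set I} {d : I → K} {i j : I} (h : B.IsGood I₀ d i j) :
    ∃ (n : ℕ) (c : Fin n → I) (π : ∀ a, B.V i ⊗ B.V j ⟶ B.V (c a))
      (ι : ∀ a, B.V (c a) ⟶ B.V i ⊗ B.V j),
      (∀ a, c a ∈ I₀ ∧ IsUnit (d (c a))) ∧ ∑ a, π a ≫ ι a = 𝟙 (B.V i ⊗ B.V j) := by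
  obtain ⟨n, c, hc, b, ⟨hb⟩, ⟨e⟩⟩ := h
  refine ⟨n, c, fun a => e.hom ≫ b.π a, fun a => b.ι a ≫ e.inv, hc, ?_⟩
  have ht := Limits.IsBilimit.total hb
  calc _ = e.hom ≫ (∑ a, b.π a ≫ b.ι a) ≫ e.inv := by
        simp only [Preadditive.sum_comp, Preadditive.comp_sum, Category.assoc]
    _ = _ := by rw [ht]; simp

theorem IsGood.summands_finite {I₀ : Set I} {d : I → K} {i j : I} (h : B.IsGood I₀ d i j) :
    (B.summands i j).Finite ∧ B.summands i j ⊆ I₀ := by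
  obtain ⟨n, c, π, ι, hc, hs⟩ := h.exists_decomposition
  have key : ∀ k ∈ B.summands i j, ∃ a, c a = k := by
    rintro k ⟨f, hf⟩
    by_contra! hk
    apply hf
    rw [← Category.comp_id f, ← hs, Preadditive.comp_sum]
    refine Finset.sum_eq_zero fun a _ => ?_
    rw [← Category.assoc, B.hom_eq_zero k (c a) (hk a).symm (f ≫ π a), Limits.zero_comp]
  constructor
  · exact (Set.finite_range c).subset fun k hk => key k hk
  · intro k hk
    obtain ⟨a, rfl⟩ := key k hk
    exact (hc a).1

variable [MonoidalPreadditive C] [MonoidalLinear K C]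

theorem pairing_eq {I₀ : Set I} {d : I → K} {i j k : I} (hk : k ∈ I₀) (x : B.H i j (B.star k))
    (y : B.H k (B.star j) (B.star i)) :
    B.pairing I₀ d i j k x y = d k * B.coeff k (bendIn x ≫ bendOut y) := by
  rw [pairing_apply, gPrime_thetaGraph d hk]

/-- The inclusions and projections of the summands equal to V_k, bent into vertices, form the
families. The pairing carries a factor d(k), cancelled by rescaling the projections; hence the
invertibility in the definition of goodness. -/
theorem IsGood.hasDualFamily {I₀ : Set I} {d : I → K} {i j : I} (h : B.IsGood I₀ d i j) (k : I) :
    HasDualFamily (B.pairing I₀ d i j k) := by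
  classical
  obtain ⟨n, c, π, ι, hc, hs⟩ := h.exists_decomposition
  -- Summands different from V_k are padded by zeros. Invertibility of `d k` is known only when some
  -- `c a` equals `k`, so the total function `Ring.inverse` is used.
  refine ⟨Fin n, inferInstance,
    fun a => if e : c a = k then (B.bendInEquiv i j k).symm (eqToHom (by rw [e]) ≫ ι a) else 0,
    fun a => if e : c a = k then
      Ring.inverse (d k) • (B.bendOutEquiv i j k).symm (π a ≫ eqToHom (by rw [e])) else 0, ?_, ?_⟩
  · intro x
    apply (B.bendInEquiv i j k).injective
    rw [map_sum]
    conv_rhs => rw [bendInEquiv_apply, ← Category.comp_id (bendIn x), ← hs, Preadditive.comp_sum]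
    refine Finset.sum_congr rfl fun a _ => ?_
    split_ifs with e
    · subst e
      rw [map_smul, map_smul, LinearEquiv.apply_symm_apply, pairing_eq (hc a).1,
        ← bendOutEquiv_apply, LinearEquiv.apply_symm_apply, smul_eq_mul, ← mul_assoc,
        Ring.inverse_mul_cancel _ (hc a).2, one_mul]
      simp only [eqToHom_refl, Category.comp_id, Category.id_comp]
      rw [← Category.assoc]
      conv_rhs => rw [← B.coeff_smul_id _ (bendIn x ≫ π a), Linear.smul_comp, Category.id_comp]
    · rw [smul_zero, map_zero, ← Category.assoc, B.hom_eq_zero k (c a) (Ne.symm e) (bendIn x ≫ π a),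
        Limits.zero_comp]
  · intro y
    apply (B.bendOutEquiv i j k).injective
    rw [map_sum]
    conv_rhs => rw [bendOutEquiv_apply, ← Category.id_comp (bendOut y), ← hs, Preadditive.sum_comp]
    refine Finset.sum_congr rfl fun a _ => ?_
    split_ifs with e
    · subst e
      rw [map_smul, map_smul, LinearEquiv.apply_symm_apply, pairing_eq (hc a).1,
        ← bendInEquiv_apply, LinearEquiv.apply_symm_apply, smul_smul, mul_right_comm,
        Ring.mul_inverse_cancel _ (hc a).2, one_mul]
      simp only [eqToHom_refl, Category.comp_id, Category.id_comp]
      rw [Category.assoc]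
      conv_rhs => rw [← B.coeff_smul_id _ (ι a ≫ bendOut y), Linear.comp_smul, Category.comp_id]
    · rw [smul_zero, map_zero, Category.assoc, B.hom_eq_zero (c a) k e (ι a ≫ bendOut y), Limits.comp_zero]

/-- `toDual` unfolds to the tensor product of four pairings, two of them flipped, and each of the
four good pairs makes one of these perfect. Since no label is asked to lie in I₀, this also covers
j₆ ∉ I₀. -/
theorem toDual_bijective {I₀ : Set I} {d : I → K} {i j k l m n : I} (hij : B.IsGood I₀ d i j)
    (hjl : B.IsGood I₀ d j l) (hin : B.IsGood I₀ d i n) (hkl : B.IsGood I₀ d k l) :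
    Function.Bijective (B.toDual I₀ d i j k l m n) :=
  ((hij.hasDualFamily k).flip.tensor ((hkl.hasDualFamily m).flip.tensor
    ((hjl.hasDualFamily n).tensor (hin.hasDualFamily m)))).bijective

open TensorProduct in
-- Bijectivity excludes the zero convention in `sixJTensor`, so pairing the tensor with vectors
-- returns the tetrahedron, cut at its edge m.
theorem toDual_sixJTensor {I₀ : Set I} {d : I → K} {i j k l m n : I}
    (h : Function.Bijective (B.toDual I₀ d i j k l m n)) (hm : m ∈ I₀)
    (x₁ : B.H i j (B.star k)) (x₂ : B.H k l (B.star m)) (x₃ : B.H n (B.star l) (B.star j))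
    (x₄ : B.H m (B.star n) (B.star i)) :
    tensorPairing (B.pairing I₀ d i j k).flip (tensorPairing (B.pairing I₀ d k l m).flip
      (tensorPairing (B.pairing I₀ d j l n) (B.pairing I₀ d i n m)))
      (B.sixJTensor I₀ d i j k l m n) (x₁ ⊗ₜ[K] (x₂ ⊗ₜ[K] (x₃ ⊗ₜ[K] x₄))) =
    d m * B.coeff m
      (bendIn x₂ ≫ bendIn x₁ ▷ B.V l ≫ (α_ _ _ _).hom ≫ B.V i ◁ bendOut x₃ ≫ bendOut x₄) := by
  have h₁ : B.toDual I₀ d i j k l m n (B.sixJTensor I₀ d i j k l m n) = B.sixJ I₀ d i j k l m n := by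
    rw [sixJTensor, dif_pos h]
    exact (LinearEquiv.ofBijective _ h).apply_symm_apply _
  have h₂ := congrArg (fun φ => φ (x₁ ⊗ₜ[K] (x₂ ⊗ₜ[K] (x₃ ⊗ₜ[K] x₄)))) h₁
  simp only [sixJ_tmul, gPrime_tetrahedron d hm] at h₂
  exact h₂

/-! ### Gluing along dual families, and both sides of the identity on vectors -/

section DualFamilyExpansions

variable {I₀ : Set I} {d : I → K} {i j k : I} {r : Type*} [Fintype r]
  {m : r → B.H i j (B.star k)} {n : r → B.H k (B.star j) (B.star i)}

theorem sum_coeff_smul_bendIn (hk : k ∈ I₀) (h : IsDualFamily (B.pairing I₀ d i j k) m n)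
    (f : B.V k ⟶ B.V i ⊗ B.V j) :
    ∑ a, (d k * B.coeff k (f ≫ bendOut (n a))) • bendIn (m a) = f := by
  have h' := congrArg (B.bendInEquiv i j k) (h.sum_left ((B.bendInEquiv i j k).symm f))
  simp only [map_sum, map_smul, pairing_eq hk, LinearEquiv.apply_symm_apply] at h'
  simpa only [← bendInEquiv_apply, LinearEquiv.apply_symm_apply] using h'

theorem sum_coeff_smul_bendOut (hk : k ∈ I₀) (h : IsDualFamily (B.pairing I₀ d i j k) m n)
    (g : B.V i ⊗ B.V j ⟶ B.V k) :
    ∑ a, (d k * B.coeff k (bendIn (m a) ≫ g)) • bendOut (n a) = g := by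
  have h' := congrArg (B.bendOutEquiv i j k) (h.sum_right ((B.bendOutEquiv i j k).symm g))
  simp only [map_sum, map_smul, pairing_eq hk, LinearEquiv.apply_symm_apply] at h'
  simpa only [← bendOutEquiv_apply, LinearEquiv.apply_symm_apply] using h'

end DualFamilyExpansions

/-- The identity of `V i ⊗ V j` expanded through all its simple summands. -/
theorem sum_bendOut_bendIn {I₀ : Set I} {d : I → K} {i j : I} (hij : B.IsGood I₀ d i j)
    (hfin : (B.summands i j).Finite) {r : I → Type} [∀ k, Fintype (r k)]
    {m : ∀ k, r k → B.H i j (B.star k)} {n : ∀ k, r k → B.H k (B.star j) (B.star i)}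
    (h : ∀ k, IsDualFamily (B.pairing I₀ d i j k) (m k) (n k)) :
    ∑ k ∈ hfin.toFinset, d k • ∑ a, bendOut (n k a) ≫ bendIn (m k a) = 𝟙 (B.V i ⊗ B.V j) := by
  obtain ⟨N, c, π, ι, hc, hs⟩ := hij.exists_decomposition
  generalize hX : ∑ k ∈ hfin.toFinset, d k • ∑ a, bendOut (n k a) ≫ bendIn (m k a) = X
  -- It suffices to see that each inclusion `ι a` absorbs `X`. In `ι a ≫ X` only k = `c a` survives,
  -- and there the chosen dual family reconstructs `ι a`.
  rw [← Category.id_comp X, ← hs, Preadditive.sum_comp]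
  refine Finset.sum_congr rfl fun a _ => ?_
  rw [Category.assoc]
  congr 1
  by_cases hι : ι a = 0
  · rw [hι, Limits.zero_comp]
  have hmem : c a ∈ hfin.toFinset := hfin.mem_toFinset.2 ⟨_, hι⟩
  rw [← hX, Preadditive.comp_sum, Finset.sum_eq_single (c a) _ (fun h => absurd hmem h)]
  · conv_rhs => rw [← sum_coeff_smul_bendIn (hc a).1 (h (c a)) (ι a)]
    rw [Linear.comp_smul, Preadditive.comp_sum, Finset.smul_sum]
    refine Finset.sum_congr rfl fun b _ => ?_
    rw [← Category.assoc]
    conv_lhs => rw [← B.coeff_smul_id _ (ι a ≫ bendOut (n (c a) b)), Linear.smul_comp,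
      Category.id_comp, smul_smul]
  · intro k _ hk
    rw [Linear.comp_smul, Preadditive.comp_sum, Finset.sum_eq_zero, smul_zero]
    intro b _
    rw [← Category.assoc, B.hom_eq_zero _ _ hk.symm (ι a ≫ _), Limits.zero_comp]

open TensorProduct in
/-- One summand of the left-hand side of the Biedenharn–Elliott identity, evaluated on vectors. -/
theorem tensorPairing_contract₃_sixJTensor {I₀ : Set I} {d : I → K}
    {j₀ j₁ j₂ j₃ j₄ j₅ j₆ j₇ j₈ j : I} (h₀ : j₀ ∈ I₀) (h₆ : j₆ ∈ I₀) (h₇ : j₇ ∈ I₀)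
    (hA : Function.Bijective (B.toDual I₀ d j₁ j₂ j₅ j₃ j₆ j))
    (hB : Function.Bijective (B.toDual I₀ d j₁ j j₆ j₄ j₀ j₇))
    (hC : Function.Bijective (B.toDual I₀ d j₂ j₃ j j₄ j₇ j₈))
    {U : Type} [Fintype U] {mu : U → B.H j₂ j₃ (B.star j)} {nu : U → B.H j (B.star j₃) (B.star j₂)}
    (hp : IsDualFamily (B.pairing I₀ d j₂ j₃ j) mu nu)
    (hq : HasDualFamily (B.pairing I₀ d j j₄ j₇)) (hr : HasDualFamily (B.pairing I₀ d j₁ j j₆))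
    (x₁ : B.H j₁ j₂ (B.star j₅)) (x₂ : B.H j₅ j₃ (B.star j₆)) (x₃ : B.H j₆ j₄ (B.star j₀))
    (y₁ : B.H j₀ (B.star j₇) (B.star j₁)) (y₂ : B.H j₇ (B.star j₈) (B.star j₂))
    (y₃ : B.H j₈ (B.star j₄) (B.star j₃)) :
    tensorPairing (tensorPairing
        (tensorPairing (B.pairing I₀ d j₅ j₃ j₆).flip (B.pairing I₀ d j₁ j₂ j₅).flip)
        (tensorPairing (B.pairing I₀ d j₆ j₄ j₀).flip (B.pairing I₀ d j₁ j₇ j₀)))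
      (tensorPairing (B.pairing I₀ d j₂ j₈ j₇) (B.pairing I₀ d j₃ j₄ j₈))
      (contract₃ (B.pairing I₀ d j₂ j₃ j) (B.pairing I₀ d j j₄ j₇) (B.pairing I₀ d j₁ j j₆)
        (B.sixJTensor I₀ d j₁ j₂ j₅ j₃ j₆ j ⊗ₜ[K] B.sixJTensor I₀ d j₁ j j₆ j₄ j₀ j₇ ⊗ₜ[K]
          B.sixJTensor I₀ d j₂ j₃ j j₄ j₇ j₈))
      (((x₂ ⊗ₜ[K] x₁) ⊗ₜ[K] (x₃ ⊗ₜ[K] y₁)) ⊗ₜ[K] (y₂ ⊗ₜ[K] y₃)) =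
    d j₀ * B.coeff j₀ (bendIn x₃ ≫ (bendIn x₂ ≫ bendIn x₁ ▷ B.V j₃ ≫ (α_ _ _ _).hom) ▷ B.V j₄ ≫
      (B.V j₁ ◁ ∑ a, bendOut (nu a) ≫ bendIn (mu a)) ▷ B.V j₄ ≫ (α_ _ _ _).hom ≫
      B.V j₁ ◁ ((α_ _ _ _).hom ≫ B.V j₂ ◁ bendOut y₃ ≫ bendOut y₂) ≫ bendOut y₁) := by
  obtain ⟨V, _, mv, nv, hq⟩ := hq
  obtain ⟨W, _, mw, nw, hr⟩ := hr
  rw [tensorPairing_contract₃ _ _ _ _ _ _ hp hq hr]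
  simp only [toDual_sixJTensor hA h₆, toDual_sixJTensor hB h₀, toDual_sixJTensor hC h₇]
  have key (a : U) : bendIn x₃ ≫ (bendIn x₂ ≫ bendIn x₁ ▷ B.V j₃ ≫ (α_ _ _ _).hom) ▷ B.V j₄ ≫
      (B.V j₁ ◁ (bendOut (nu a) ≫ bendIn (mu a))) ▷ B.V j₄ ≫ (α_ _ _ _).hom ≫
      B.V j₁ ◁ ((α_ _ _ _).hom ≫ B.V j₂ ◁ bendOut y₃ ≫ bendOut y₂) ≫ bendOut y₁ =
      bendIn x₃ ≫ (bendIn x₂ ≫ bendIn x₁ ▷ B.V j₃ ≫ (α_ _ _ _).hom ≫ B.V j₁ ◁ bendOut (nu a)) ▷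
        B.V j₄ ≫ (α_ _ _ _).hom ≫ B.V j₁ ◁ (bendIn (mu a) ▷ B.V j₄ ≫ (α_ _ _ _).hom ≫
          B.V j₂ ◁ bendOut y₃ ≫ bendOut y₂) ≫ bendOut y₁ := by
    monoidal
  -- The first symbol supplies the coordinates of `f` in the family for (j₁, j, j₆), the third those
  -- of `g` in the family for (j, j₄, j₇). Summing over `b` and `c` therefore reassembles `f` and
  -- `g`, and only the sum over `a` remains.
  have expand (f : B.V j₆ ⟶ B.V j₁ ⊗ B.V j) (g : B.V j ⊗ B.V j₄ ⟶ B.V j₇) :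
      bendIn x₃ ≫ f ▷ B.V j₄ ≫ (α_ _ _ _).hom ≫ B.V j₁ ◁ g ≫ bendOut y₁ =
        ∑ b, ∑ c, (d j₇ * B.coeff j₇ (bendIn (mv b) ≫ g)) •
          (d j₆ * B.coeff j₆ (f ≫ bendOut (nw c))) •
          (bendIn x₃ ≫ bendIn (mw c) ▷ B.V j₄ ≫ (α_ _ _ _).hom ≫ B.V j₁ ◁ bendOut (nv b) ≫
            bendOut y₁) := by
    conv_lhs => rw [← sum_coeff_smul_bendIn h₆ hr f, ← sum_coeff_smul_bendOut h₇ hq g]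
    simp only [Preadditive.sum_comp, Preadditive.comp_sum, sum_whiskerRight, whiskerLeft_sum,
      MonoidalLinear.smul_whiskerRight, MonoidalLinear.whiskerLeft_smul, Linear.smul_comp,
      Linear.comp_smul, Finset.smul_sum]
  simp only [whiskerLeft_sum, sum_whiskerRight, Preadditive.sum_comp, Preadditive.comp_sum,
    map_sum, Finset.mul_sum]
  refine Finset.sum_congr rfl fun a _ => ?_
  rw [key, expand]
  simp only [map_sum, Finset.mul_sum, map_smul, smul_eq_mul, Category.assoc]
  refine Finset.sum_congr rfl fun b _ => ?_
  refine Finset.sum_congr rfl fun c _ => ?_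
  ring

open TensorProduct in
/-- The right-hand side of the Biedenharn–Elliott identity, evaluated on vectors. -/
theorem tensorPairing_contract₁_sixJTensor {I₀ : Set I} {d : I → K}
    {j₀ j₁ j₂ j₃ j₄ j₅ j₆ j₇ j₈ : I} (h₀ : j₀ ∈ I₀)
    (hA : Function.Bijective (B.toDual I₀ d j₅ j₃ j₆ j₄ j₀ j₈))
    (hB : Function.Bijective (B.toDual I₀ d j₁ j₂ j₅ j₈ j₀ j₇))
    (hr : HasDualFamily (B.pairing I₀ d j₅ j₈ j₀))
    (x₁ : B.H j₁ j₂ (B.star j₅)) (x₂ : B.H j₅ j₃ (B.star j₆)) (x₃ : B.H j₆ j₄ (B.star j₀))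
    (y₁ : B.H j₀ (B.star j₇) (B.star j₁)) (y₂ : B.H j₇ (B.star j₈) (B.star j₂))
    (y₃ : B.H j₈ (B.star j₄) (B.star j₃)) :
    tensorPairing (tensorPairing
        (tensorPairing (B.pairing I₀ d j₅ j₃ j₆).flip (B.pairing I₀ d j₁ j₂ j₅).flip)
        (tensorPairing (B.pairing I₀ d j₆ j₄ j₀).flip (B.pairing I₀ d j₁ j₇ j₀)))
      (tensorPairing (B.pairing I₀ d j₂ j₈ j₇) (B.pairing I₀ d j₃ j₄ j₈))
      (contract₁ (B.pairing I₀ d j₅ j₈ j₀)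
        (B.sixJTensor I₀ d j₅ j₃ j₆ j₄ j₀ j₈ ⊗ₜ[K] B.sixJTensor I₀ d j₁ j₂ j₅ j₈ j₀ j₇))
      (((x₂ ⊗ₜ[K] x₁) ⊗ₜ[K] (x₃ ⊗ₜ[K] y₁)) ⊗ₜ[K] (y₂ ⊗ₜ[K] y₃)) =
    d j₀ * B.coeff j₀ (bendIn x₃ ≫ (bendIn x₂ ≫ bendIn x₁ ▷ B.V j₃ ≫ (α_ _ _ _).hom) ▷ B.V j₄ ≫
      (α_ _ _ _).hom ≫
      B.V j₁ ◁ ((α_ _ _ _).hom ≫ B.V j₂ ◁ bendOut y₃ ≫ bendOut y₂) ≫ bendOut y₁) := by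
  obtain ⟨W, _, mw, nw, hr⟩ := hr
  rw [tensorPairing_contract₁ _ _ _ _ _ _ hr]
  simp only [toDual_sixJTensor hA h₀, toDual_sixJTensor hB h₀]
  -- Apart from coherence, the only move is to interchange the splitting by `x₁` with the fusion by
  -- `y₃`. The bracketed factor is then expanded in the family for (j₅, j₈, j₀).
  have key : bendIn x₃ ≫ (bendIn x₂ ≫ bendIn x₁ ▷ B.V j₃ ≫ (α_ _ _ _).hom) ▷ B.V j₄ ≫
      (α_ _ _ _).hom ≫ B.V j₁ ◁ ((α_ _ _ _).hom ≫ B.V j₂ ◁ bendOut y₃ ≫ bendOut y₂) ≫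
        bendOut y₁ =
      (bendIn x₃ ≫ bendIn x₂ ▷ B.V j₄ ≫ (α_ _ _ _).hom ≫ B.V j₅ ◁ bendOut y₃) ≫
        bendIn x₁ ▷ B.V j₈ ≫ (α_ _ _ _).hom ≫ B.V j₁ ◁ bendOut y₂ ≫ bendOut y₁ := by
    simp only [Category.assoc]
    rw [whisker_exchange_assoc]
    monoidal
  rw [key]
  conv_rhs => rw [← sum_coeff_smul_bendIn h₀ hr (bendIn x₃ ≫ bendIn x₂ ▷ B.V j₄ ≫ (α_ _ _ _).hom ≫ B.V j₅ ◁ bendOut y₃)]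
  simp only [Preadditive.sum_comp, Linear.smul_comp, map_sum, map_smul, Finset.mul_sum,
    smul_eq_mul, Category.assoc]
  refine Finset.sum_congr rfl fun c _ => ?_
  ring

end BasicData
end ModifiedSixJ

/-! ### The Biedenharn–Elliott identity -/

open TensorProduct in
theorem mainTheorem3 {K : Type*} [CommRing K] {C : Type*} [Category C] [MonoidalCategory C]
    [Preadditive C] [Linear K C] [MonoidalPreadditive C] [MonoidalLinear K C]
    [ModifiedSixJ.PivotalCategory C]
    (hK : Function.Bijective fun a : K => a • 𝟙 (𝟙_ C))
    {I : Type*} (B : ModifiedSixJ.BasicData K C I)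
    (I₀ : Set I) (d : I → K) (hd : B.IsTAmbi I₀ d)
    (j₀ j₁ j₂ j₃ j₄ j₅ j₆ j₇ j₈ : I)
    (h₁ : B.IsStronglyGood I₀ d j₁ j₂ j₅ j₈ j₀ j₇)
    (h₂ : B.IsStronglyGood I₀ d j₅ j₃ j₆ j₄ j₀ j₈)
    (h₇ : j₇ ∈ I₀) (h₈ : j₈ ∈ I₀) (h₂₃ : B.IsGood I₀ d j₂ j₃)
    (hJ : ∀ j ∈ B.summands j₂ j₃, B.IsGood I₀ d j₁ j ∧ B.IsGood I₀ d j j₄) :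
    B.summands j₂ j₃ ⊆ I₀ ∧
    -- strong goodness of the tuples
    (∀ j ∈ B.summands j₂ j₃,
      (j₆ ∈ I₀ → B.IsStronglyGood I₀ d j₁ j₂ j₅ j₃ j₆ j) ∧
      B.IsStronglyGood I₀ d j₁ j j₆ j₄ j₀ j₇ ∧
      B.IsStronglyGood I₀ d j₂ j₃ j j₄ j₇ j₈) ∧
    -- the pairings turn the symbols into elements of tensor products
    (∀ j ∈ B.summands j₂ j₃,
      Function.Bijective (B.toDual I₀ d j₁ j₂ j₅ j₃ j₆ j) ∧
      Function.Bijective (B.toDual I₀ d j₁ j j₆ j₄ j₀ j₇) ∧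
      Function.Bijective (B.toDual I₀ d j₂ j₃ j j₄ j₇ j₈)) ∧
    Function.Bijective (B.toDual I₀ d j₅ j₃ j₆ j₄ j₀ j₈) ∧
    Function.Bijective (B.toDual I₀ d j₁ j₂ j₅ j₈ j₀ j₇) ∧
    -- the identity
    ∃ hfin : (B.summands j₂ j₃).Finite,
      ∑ j ∈ hfin.toFinset, d j •
        ModifiedSixJ.contract₃ (B.pairing I₀ d j₂ j₃ j) (B.pairing I₀ d j j₄ j₇)
          (B.pairing I₀ d j₁ j j₆)
          (B.sixJTensor I₀ d j₁ j₂ j₅ j₃ j₆ j ⊗ₜ[K] B.sixJTensor I₀ d j₁ j j₆ j₄ j₀ j₇ ⊗ₜ[K]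
            B.sixJTensor I₀ d j₂ j₃ j j₄ j₇ j₈) =
        ModifiedSixJ.contract₁ (B.pairing I₀ d j₅ j₈ j₀)
          (B.sixJTensor I₀ d j₅ j₃ j₆ j₄ j₀ j₈ ⊗ₜ[K]
            B.sixJTensor I₀ d j₁ j₂ j₅ j₈ j₀ j₇) := by
  obtain ⟨hfin, hsub⟩ := h₂₃.summands_finite
  have hA : ∀ j ∈ B.summands j₂ j₃, Function.Bijective (B.toDual I₀ d j₁ j₂ j₅ j₃ j₆ j) :=
    fun j hj => ModifiedSixJ.BasicData.toDual_bijective h₁.ij h₂₃ (hJ j hj).1 h₂.ij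
  have hB : ∀ j ∈ B.summands j₂ j₃, Function.Bijective (B.toDual I₀ d j₁ j j₆ j₄ j₀ j₇) :=
    fun j hj => ModifiedSixJ.BasicData.toDual_bijective (hJ j hj).1 (hJ j hj).2 h₁.i_n h₂.kl
  have hC : ∀ j ∈ B.summands j₂ j₃, Function.Bijective (B.toDual I₀ d j₂ j₃ j j₄ j₇ j₈) :=
    fun j hj => ModifiedSixJ.BasicData.toDual_bijective h₂₃ h₂.jl h₁.jl (hJ j hj).2
  have hD : Function.Bijective (B.toDual I₀ d j₅ j₃ j₆ j₄ j₀ j₈) :=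
    ModifiedSixJ.BasicData.toDual_bijective h₂.ij h₂.jl h₂.i_n h₂.kl
  have hE : Function.Bijective (B.toDual I₀ d j₁ j₂ j₅ j₈ j₀ j₇) :=
    ModifiedSixJ.BasicData.toDual_bijective h₁.ij h₁.jl h₁.i_n h₁.kl
  refine ⟨hsub, fun j hj => ⟨fun h₆ => ⟨h₆, hsub hj, h₁.ij, h₂₃, (hJ j hj).1, h₂.ij⟩,
    ⟨h₁.m_mem, h₇, (hJ j hj).1, (hJ j hj).2, h₁.i_n, h₂.kl⟩,
    ⟨h₇, h₈, h₂₃, h₂.jl, h₁.jl, (hJ j hj).2⟩⟩,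
    fun j hj => ⟨hA j hj, hB j hj, hC j hj⟩, hD, hE, hfin, ?_⟩
  -- The six factors of the target module are paired with their duals. These pairings are perfect by
  -- strong goodness of the two given tuples, so testing on pure tensors decides equality.
  apply ((((h₂.ij.hasDualFamily j₆).flip.tensor (h₁.ij.hasDualFamily j₅).flip).tensor
    ((h₂.kl.hasDualFamily j₀).flip.tensor (h₁.i_n.hasDualFamily j₀))).tensor
    ((h₁.jl.hasDualFamily j₇).tensor (h₂.jl.hasDualFamily j₈))).bijective.injective
  refine ModifiedSixJ.tensor_ext₆ fun x₁ x₂ x₃ y₁ y₂ y₃ => ?_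
  -- The first symbol on the left is evaluated by a cut at its edge j₆, which requires j₆ ∈ I₀.
  by_cases h₆ : j₆ ∈ I₀
  · choose r hr m n hmn using h₂₃.hasDualFamily
    rw [ModifiedSixJ.BasicData.tensorPairing_contract₁_sixJTensor h₁.m_mem hD hE
      (h₂.i_n.hasDualFamily j₀)]
    have hsum := ModifiedSixJ.BasicData.sum_bendOut_bendIn h₂₃ hfin hmn
    simp only [map_sum, LinearMap.sum_apply, map_smul, LinearMap.smul_apply]
    rw [Finset.sum_congr rfl fun j hj => congrArg (d j • ·)
      (ModifiedSixJ.BasicData.tensorPairing_contract₃_sixJTensor h₁.m_mem h₆ h₇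
        (hA j (hfin.mem_toFinset.1 hj)) (hB j (hfin.mem_toFinset.1 hj))
        (hC j (hfin.mem_toFinset.1 hj)) (hmn j)
        ((hJ j (hfin.mem_toFinset.1 hj)).2.hasDualFamily j₇)
        ((hJ j (hfin.mem_toFinset.1 hj)).1.hasDualFamily j₆) x₁ x₂ x₃ y₁ y₂ y₃)]
    have lin (S : I → (B.V j₂ ⊗ B.V j₃ ⟶ B.V j₂ ⊗ B.V j₃)) {X Y : C}
        (f : X ⟶ (B.V j₁ ⊗ (B.V j₂ ⊗ B.V j₃)) ⊗ B.V j₄)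
        (g : (B.V j₁ ⊗ (B.V j₂ ⊗ B.V j₃)) ⊗ B.V j₄ ⟶ Y) :
        f ≫ (B.V j₁ ◁ ∑ j ∈ hfin.toFinset, d j • S j) ▷ B.V j₄ ≫ g =
          ∑ j ∈ hfin.toFinset, d j • (f ≫ (B.V j₁ ◁ S j) ▷ B.V j₄ ≫ g) := by
      simp only [whiskerLeft_sum, sum_whiskerRight, Preadditive.sum_comp, Preadditive.comp_sum,
        MonoidalLinear.smul_whiskerRight, MonoidalLinear.whiskerLeft_smul, Linear.smul_comp,
        Linear.comp_smul]
    have key := lin (fun j => ∑ a, ModifiedSixJ.BasicData.bendOut (n j a) ≫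
        ModifiedSixJ.BasicData.bendIn (m j a))
      (ModifiedSixJ.BasicData.bendIn x₃ ≫ (ModifiedSixJ.BasicData.bendIn x₂ ≫
        ModifiedSixJ.BasicData.bendIn x₁ ▷ B.V j₃ ≫ (α_ _ _ _).hom) ▷ B.V j₄)
      ((α_ _ _ _).hom ≫ B.V j₁ ◁ ((α_ _ _ _).hom ≫
        B.V j₂ ◁ ModifiedSixJ.BasicData.bendOut y₃ ≫ ModifiedSixJ.BasicData.bendOut y₂) ≫
        ModifiedSixJ.BasicData.bendOut y₁)
    -- The sum over j of the weighted insertions is the identity of V_{j₂} ⊗ V_{j₃}; removing it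
    -- leaves the right-hand side.
    rw [hsum, MonoidalCategory.whiskerLeft_id, MonoidalCategory.id_whiskerRight,
      Category.id_comp] at key
    simp only [Category.assoc] at key ⊢
    rw [key, map_sum, Finset.mul_sum]
    simp only [map_smul, smul_eq_mul, mul_left_comm]
  -- A nonzero `x₂` would bend to a nonzero morphism V_{j₆} ⟶ V_{j₅} ⊗ V_{j₃}, placing j₆ among the
  -- summands of a good pair and hence in I₀.
  · have hx : x₂ = 0 := by
      by_contra hx
      refine h₆ (h₂.ij.summands_finite.2 ⟨ModifiedSixJ.BasicData.bendIn x₂, fun h => hx ?_⟩)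
      exact (B.bendInEquiv j₅ j₃ j₆).map_eq_zero_iff.1 h
    simp only [hx, TensorProduct.zero_tmul, map_zero]
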